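/- Let $\Delta\ge 2$ be an integer and let $\lambda\in\mathbb{C}$ be such that $|\lambda|<\lambda^*(\Delta):=\frac{(\Delta-1)^{\Delta-1}}{\Delta^{\Delta}}$. For a finite simple graph $G=(V,E)$ let $Z(G)(\lambda)=\sum_{I}\lambda^{|I|}$, the sum ranging over all independent sets $I\subseteq V$, be its independence polynomial. For non-zero complex numbers $q,\xi$, call $\xi$ a multiplicative $\varepsilon$-approximation to $q$ if $e^{-\varepsilon}\le |q|/|\xi|\le e^{\varepsilon}$ and the angle between $\xi$ and $q$, seen as vectors in $\mathbb{C}=\mathbb{R}^2$, is at most $\varepsilon$. Then there exists a deterministic algorithm which, given (the adjacency lists of) a finite simple graph $G=(V,E)$ of maximum degree at most $\Delta$ and a real number $\varepsilon>0$, computes a multiplicative $\varepsilon$-approximation to $Z(G)(\lambda)$ (in particular $Z(G)(\lambda)\neq 0$) in time $(|V|/\varepsilon)^{O(1)}$. Precisely, there is a constant $K$, depending only on $\Delta$ and $\lambda$, such that the running time is at most $K\left(\frac{|V|+1}{\min(\varepsilon,1)}\right)^{K}$. Here an algorithm is a program of a random access machine over the real numbers that has access to $\varepsilon$, $\operatorname{Re}\lambda$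 and $\operatorname{Im}\lambda$, and the running time is its number of steps, each arithmetic operation on or comparison of two real numbers, and each elementary operation on natural numbers (addition, subtraction, comparison, memory access), counting as one step. -/

import Mathlib

/-! ### The independence polynomial and multiplicative approximation -/

open Classical in
/-- The independence polynomial `Z(G) = ∑ X ^ |I|`, summed over the independent sets `I` of `G`. -/
noncomputable def SimpleGraph.independencePolynomial {V : Type*} [Fintype V]
    (G : SimpleGraph V) : Polynomial ℂ :=
  ∑ I ∈ Finset.univ.filter (fun I : Finset V => G.IsIndepSet (I : Set V)),
    Polynomial.X ^ I.card

/-- `ξ` is a multiplicative `ε`-approximation to `q`: both are nonzero,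
`e ^ (-ε) ≤ |q| / |ξ| ≤ e ^ ε`, and the angle between `ξ` and `q`, seen as vectors of the
Euclidean plane, is at most `ε`. -/
def IsMultApprox (ε : ℝ) (q ξ : ℂ) : Prop :=
  q ≠ 0 ∧ ξ ≠ 0 ∧
    Real.exp (-ε) ≤ ‖q‖ / ‖ξ‖ ∧ ‖q‖ / ‖ξ‖ ≤ Real.exp ε ∧
    InnerProductGeometry.angle ξ q ≤ ε

/-- The threshold `λ*(Δ) = (Δ - 1) ^ (Δ - 1) / Δ ^ Δ` (meant for `1 ≤ Δ`). -/
noncomputable def lambdaStar (Δ : ℕ) : ℝ :=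
  ((Δ : ℝ) - 1) ^ (Δ - 1) / (Δ : ℝ) ^ Δ

/-! ### The machine model: a real random access machine

Programs are finite pieces of text whose literals are natural numbers and rational numbers. They
work on natural numbers (used as counters and addresses; addition and truncated subtraction only)
and on real numbers (the four field operations and comparison). There is no rounding or truncation
from the reals to the naturals. Every elementary operation and every test costs one step. -/

namespace RealRAM

/-- The memory: registers and arrays for natural numbers, registers and arrays for real numbers.
Registers and arrays are named by natural numbers that are fixed in the program text; the position
inside an array is computed at run time. -/
structure Store where
  natReg : ℕ → ℕ
  realReg : ℕ → ℝ
  natArr : ℕ → ℕ → ℕ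
  realArr : ℕ → ℕ → ℝ

/-- The elementary operations. The first argument names the target. -/
inductive Instr where
  /-- natural register `d` gets the literal `k` -/
  | natConst (d k : ℕ)
  /-- natural register `d` gets the value of register `a` -/
  | natCopy (d a : ℕ)
  /-- natural register `d` gets the sum of registers `a`, `b` -/
  | natAdd (d a b : ℕ)
  /-- natural register `d` gets the truncated difference of registers `a`, `b` -/
  | natSub (d a b : ℕ)
  /-- natural register `d` gets the entry of natural array `A` at the position held by `i` -/
  | natLoad (d A i : ℕ)
  /-- the entry of natural array `A` at the position held by `i` gets the value of register `a` -/
  | natStore (A i a : ℕ)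
  /-- real register `d` gets the literal `q` -/
  | realConst (d : ℕ) (q : ℚ)
  /-- real register `d` gets the value of real register `a` -/
  | realCopy (d a : ℕ)
  /-- real register `d` gets the value of natural register `a` -/
  | realOfNat (d a : ℕ)
  /-- real register `d` gets the sum of real registers `a`, `b` -/
  | realAdd (d a b : ℕ)
  /-- real register `d` gets the difference of real registers `a`, `b` -/
  | realSub (d a b : ℕ)
  /-- real register `d` gets the product of real registers `a`, `b` -/
  | realMul (d a b : ℕ)
  /-- real register `d` gets the quotient of real registers `a`, `b`; dividing by zero gives zero,
  which a program could also arrange by a test -/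
  | realDiv (d a b : ℕ)
  /-- real register `d` gets the entry of real array `A` at the position held by `i` -/
  | realLoad (d A i : ℕ)
  /-- the entry of real array `A` at the position held by `i` gets the value of real register
  `a` -/
  | realStore (A i a : ℕ)

/-- Writing into a natural register. -/
def Store.setNat (s : Store) (d x : ℕ) : Store :=
  { s with natReg := Function.update s.natReg d x }

/-- Writing into a real register. -/
noncomputable def Store.setReal (s : Store) (d : ℕ) (x : ℝ) : Store :=
  { s with realReg := Function.update s.realReg d x }

/-- Writing into a natural array. -/
def Store.setNatArr (s : Store) (A i x : ℕ) : Store :=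
  { s with natArr := Function.update s.natArr A (Function.update (s.natArr A) i x) }

/-- Writing into a real array. -/
noncomputable def Store.setRealArr (s : Store) (A i : ℕ) (x : ℝ) : Store :=
  { s with realArr := Function.update s.realArr A (Function.update (s.realArr A) i x) }

/-- The effect of an elementary operation. -/
noncomputable def Instr.run (s : Store) : Instr → Store
  | natConst d k => s.setNat d k
  | natCopy d a => s.setNat d (s.natReg a)
  | natAdd d a b => s.setNat d (s.natReg a + s.natReg b)
  | natSub d a b => s.setNat d (s.natReg a - s.natReg b)
  | natLoad d A i => s.setNat d (s.natArr A (s.natReg i))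
  | natStore A i a => s.setNatArr A (s.natReg i) (s.natReg a)
  | realConst d q => s.setReal d q
  | realCopy d a => s.setReal d (s.realReg a)
  | realOfNat d a => s.setReal d (s.natReg a)
  | realAdd d a b => s.setReal d (s.realReg a + s.realReg b)
  | realSub d a b => s.setReal d (s.realReg a - s.realReg b)
  | realMul d a b => s.setReal d (s.realReg a * s.realReg b)
  | realDiv d a b => s.setReal d (s.realReg a / s.realReg b)
  | realLoad d A i => s.setReal d (s.realArr A (s.natReg i))
  | realStore A i a => s.setRealArr A (s.natReg i) (s.realReg a)

/-- The tests: comparison of two natural or of two real registers. -/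
inductive Test where
  | natLt (a b : ℕ)
  | realLt (a b : ℕ)

/-- The truth value of a test. -/
def Test.Holds (s : Store) : Test → Prop
  | natLt a b => s.natReg a < s.natReg b
  | realLt a b => s.realReg a < s.realReg b

/-- Programs. -/
inductive Program where
  | skip
  | instr (i : Instr)
  | seq (p q : Program)
  | ite (c : Test) (p q : Program)
  | while (c : Test) (p : Program)

/-- `Exec p s s' t`: started on the memory `s`, the program `p` halts with memory `s'` after
exactly `t` steps. -/
inductive Exec : Program → Store → Store → ℕ → Prop where
  | skip (s : Store) : Exec .skip s s 0
  | instr (i : Instr) (s : Store) : Exec (.instr i) s (i.run s) 1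
  | seq {p q : Program} {s₁ s₂ s₃ : Store} {t₁ t₂ : ℕ} :
      Exec p s₁ s₂ t₁ → Exec q s₂ s₃ t₂ → Exec (.seq p q) s₁ s₃ (t₁ + t₂)
  | iteTrue {c : Test} {p q : Program} {s s' : Store} {t : ℕ} :
      c.Holds s → Exec p s s' t → Exec (.ite c p q) s s' (t + 1)
  | iteFalse {c : Test} {p q : Program} {s s' : Store} {t : ℕ} :
      ¬ c.Holds s → Exec q s s' t → Exec (.ite c p q) s s' (t + 1)
  | whileFalse {c : Test} {p : Program} {s : Store} :
      ¬ c.Holds s → Exec (.while c p) s s 1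
  | whileTrue {c : Test} {p : Program} {s₁ s₂ s₃ : Store} {t₁ t₂ : ℕ} :
      c.Holds s₁ → Exec p s₁ s₂ t₁ → Exec (.while c p) s₂ s₃ t₂ →
        Exec (.while c p) s₁ s₃ (t₁ + t₂ + 1)

/-- Programs are deterministic: the result and the number of steps are functions of the input. -/
theorem Exec.deterministic {p : Program} {s s' s'' : Store} {t t' : ℕ}
    (h : Exec p s s' t) (h' : Exec p s s'' t') : s' = s'' ∧ t = t' := by
  induction h generalizing s'' t' with
  | skip => cases h'; exact ⟨rfl, rfl⟩
  | instr => cases h'; exact ⟨rfl, rfl⟩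
  | seq _ _ ih₁ ih₂ =>
    cases h' with
    | seq a b =>
      obtain ⟨rfl, rfl⟩ := ih₁ a
      obtain ⟨rfl, rfl⟩ := ih₂ b
      exact ⟨rfl, rfl⟩
  | iteTrue hc _ ih =>
    cases h' with
    | iteTrue _ a => obtain ⟨rfl, rfl⟩ := ih a; exact ⟨rfl, rfl⟩
    | iteFalse hn _ => exact absurd hc hn
  | iteFalse hc _ ih =>
    cases h' with
    | iteTrue hn _ => exact absurd hn hc
    | iteFalse _ a => obtain ⟨rfl, rfl⟩ := ih a; exact ⟨rfl, rfl⟩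
  | whileFalse hc =>
    cases h' with
    | whileFalse _ => exact ⟨rfl, rfl⟩
    | whileTrue hn _ _ => exact absurd hn hc
  | whileTrue hc _ _ ih₁ ih₂ =>
    cases h' with
    | whileFalse hn => exact absurd hc hn
    | whileTrue _ a b =>
      obtain ⟨rfl, rfl⟩ := ih₁ a
      obtain ⟨rfl, rfl⟩ := ih₂ b
      exact ⟨rfl, rfl⟩

/-- `L` is an adjacency list representation of `G`: for every vertex `v` the list `L v` holds
each neighbour of `v` exactly once, in any order. -/
def IsAdjacencyList {n : ℕ} (G : SimpleGraph (Fin n)) (L : Fin n → List (Fin n)) : Prop :=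
  ∀ v, (L v).Nodup ∧ ∀ w, w ∈ L v ↔ G.Adj v w

/-- All adjacency lists one after another, `L 0 ++ L 1 ++ ⋯ ++ L (n - 1)`. -/
def entries {n : ℕ} (L : Fin n → List (Fin n)) : List ℕ :=
  (List.ofFn fun v => (L v).map Fin.val).flatten

/-- The position in `entries L` at which the list of the vertex `v` begins (and at which the list
of the vertex `v - 1` ends), for `v ≤ n`. -/
def startPos {n : ℕ} (L : Fin n → List (Fin n)) (v : ℕ) : ℕ :=
  ∑ u : Fin n with u.val < v, (L u).length

/-- The initial memory. Natural register `0` holds the number of vertices, natural array `0` holds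
at the positions `0, …, n` where the adjacency lists begin and end in natural array `1`, which
holds the concatenated adjacency lists. Real register `0` holds `ε`, and real registers `1` and `2`
hold the real and the imaginary part of `lam`. Everything else is zero. -/
noncomputable def input {n : ℕ} (L : Fin n → List (Fin n)) (ε : ℝ) (lam : ℂ) : Store where
  natReg r := if r = 0 then n else 0
  realReg r := if r = 0 then ε else if r = 1 then lam.re else if r = 2 then lam.im else 0
  natArr A i :=
    if A = 0 then (if i ≤ n then startPos L i else 0)
    else if A = 1 then (entries L).getD i 0
    else 0
  realArr _ _ := 0

/-- The output: the complex number whose real and imaginary parts are in real registers `0`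
and `1`. -/
def output (s : Store) : ℂ := ⟨s.realReg 0, s.realReg 1⟩

end RealRAM

/-! Deleting the vertices of G one after another gives Z(G) = ∏ (1 + R(S,v)), where S is the set
already deleted and R(S,v) = λ Z(G - S - N[v]) / Z(G - S - v). Deleting the neighbours of v one by
one in the same way turns the ratio into R(S,v) = λ / ∏ (1 + R(T,w)), with w running over the
remaining neighbours of v (`hardcoreSum_eq_prodAlong`, `hardcoreRatio_eq`).

Below the root of this recursion every vertex has lost the neighbour through which it was reached,
so at most Δ - 1 factors occur. On the polydisc |x_i| ≤ 1/Δ the map λ / ∏ (1 + x_i) is then bounded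
by |λ| (1 - 1/Δ)^(-(Δ-1)), and its Lipschitz constant for the sup norm is at most |λ| (Δ - 1) (1 -
1/Δ)^(-Δ) = |λ| Δ (1 - 1/Δ)^(-(Δ-1)). At |λ| = λ* the last quantity is 1 (`lambdaStar_mul_eq_one`),
so below λ* the polydisc is preserved and the recursion contracts by some c < 1. Invariance gives Z
≠ 0 (`hardcoreSum_ne_zero_and`); contraction shows that breaking off at depth d costs O(c^d) per
ratio (`norm_hardcoreRatio_sub_le`), hence O(n c^d) in log Z (`eval_eq_prodAlong_mul_exp`).

A depth d of order log(n/ε) therefore suffices, and the recursion tree, of size exponential in d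
with base depending on Δ, is polynomial in n/ε (`time_le`). It remains to carry out the recursion
with loops only. A stack automaton `Config.step` is shown to compute `truncRatio`
(`evaluates_truncRatio`), and a program is shown to simulate the automaton (`Represents.step`,
`Represents.roots`). Undoing the deletions of a finished branch costs one step: a deleted vertex
carries the identifier of a frame, and it returns when that identifier is declared dead. -/

/-! ### Products along lists -/

section ProdAlong

variable {V : Type*} [DecidableEq V]

/-- The product of the factors `1 + X T w` for `w` in a list, where `T` consists of `S` and the
members of the list before `w`; the members that are already in `T` are skipped. -/
def prodAlong (X : Finset V → V → ℂ) : Finset V → List V → ℂ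
  | _, [] => 1
  | S, w :: l => if w ∈ S then prodAlong X S l else (1 + X S w) * prodAlong X (insert w S) l

/-- The approximation to `hardcoreRatio` given by the recursion broken off at depth `d`. -/
noncomputable def truncRatio (lam : ℂ) (L : V → List V) : ℕ → Finset V → V → ℂ
  | 0, _, _ => lam
  | d + 1, S, v => lam / prodAlong (truncRatio lam L d) (insert v S) (L v)

/-- The number of members of a list that are not in `S`. -/
def freeCount (S : Finset V) (l : List V) : ℕ := l.countP (fun w => w ∉ S)

theorem freeCount_cons_of_mem {S : Finset V} {w : V} (h : w ∈ S) (l : List V) :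
    freeCount S (w :: l) = freeCount S l := by
  simp [freeCount, h]

theorem freeCount_cons_of_notMem {S : Finset V} {w : V} (h : w ∉ S) (l : List V) :
    freeCount S (w :: l) = freeCount S l + 1 := by
  simp [freeCount, h]

theorem freeCount_anti {S T : Finset V} (h : S ⊆ T) (l : List V) :
    freeCount T l ≤ freeCount S l := by
  refine List.countP_mono_left fun x _ hx => ?_
  simp only [decide_eq_true_eq] at hx ⊢
  exact fun hS => hx (h hS)

theorem freeCount_le_length (S : Finset V) (l : List V) : freeCount S l ≤ l.length :=
  List.countP_le_length

theorem freeCount_lt_length {S : Finset V} {l : List V} {v : V} (hv : v ∈ l) (hS : v ∈ S) :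
    freeCount S l < l.length := by
  rcases lt_or_eq_of_le (freeCount_le_length S l) with h | h
  · exact h
  · have := (List.countP_eq_length.1 h) v hv
    simp [hS] at this

theorem norm_inv_one_add_le {r : ℝ} (hr : r < 1) {x : ℂ} (hx : ‖x‖ ≤ r) :
    1 + x ≠ 0 ∧ ‖(1 + x)⁻¹‖ ≤ (1 - r)⁻¹ := by
  have h : 1 - r ≤ ‖1 + x‖ := by
    have := norm_sub_norm_le (1 : ℂ) (-x)
    rw [sub_neg_eq_add, norm_neg, norm_one] at this
    linarith
  have h0 : 0 < 1 - r := by linarith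
  refine ⟨fun h' => ?_, ?_⟩
  · rw [h', norm_zero] at h
    linarith
  · rw [norm_inv]
    exact inv_anti₀ h0 h

variable {X Y : Finset V → V → ℂ} {r : ℝ}

theorem norm_inv_prodAlong_le (h0 : 0 ≤ r) (h1 : r < 1) (l : List V) :
    ∀ S : Finset V, (∀ T w, S ⊆ T → w ∉ T → w ∈ l → ‖X T w‖ ≤ r) →
    prodAlong X S l ≠ 0 ∧ ‖(prodAlong X S l)⁻¹‖ ≤ (1 - r)⁻¹ ^ freeCount S l := by
  have hA : 1 ≤ (1 - r)⁻¹ := (one_le_inv₀ (by linarith)).2 (by linarith)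
  induction l with
  | nil => intro S _; simp [prodAlong, freeCount]
  | cons w l ih =>
    intro S h
    by_cases hw : w ∈ S
    · rw [freeCount_cons_of_mem hw]
      simpa [prodAlong, hw] using ih S (fun T u hT hu hl => h T u hT hu (by simp [hl]))
    · rw [freeCount_cons_of_notMem hw]
      simp only [prodAlong, hw, if_false]
      obtain ⟨a0, a1⟩ := ih (insert w S)
        (fun T u hT hu hl => h T u ((Finset.subset_insert _ _).trans hT) hu (by simp [hl]))
      obtain ⟨b0, b1⟩ := norm_inv_one_add_le h1 (h S w subset_rfl hw (by simp))
      refine ⟨mul_ne_zero b0 a0, ?_⟩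
      rw [mul_inv, norm_mul, pow_succ']
      refine mul_le_mul b1 (a1.trans ?_) (norm_nonneg _) (by positivity)
      exact pow_le_pow_right₀ hA (freeCount_anti (Finset.subset_insert _ _) l)

/-- The factors are exchanged one at a time. With A = (1 - r)⁻¹, exchanging one inverse factor costs
A²δ, and each of the other inverse factors is at most A. -/
theorem norm_inv_prodAlong_sub_le (h0 : 0 ≤ r) (h1 : r < 1) {δ : ℝ} (hδ : 0 ≤ δ) (l : List V) :
    ∀ S : Finset V, (∀ T w, S ⊆ T → w ∉ T → w ∈ l → ‖X T w‖ ≤ r) →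
    (∀ T w, S ⊆ T → w ∉ T → w ∈ l → ‖Y T w‖ ≤ r) →
    (∀ T w, S ⊆ T → w ∉ T → w ∈ l → ‖X T w - Y T w‖ ≤ δ) →
    ‖(prodAlong X S l)⁻¹ - (prodAlong Y S l)⁻¹‖ ≤
      freeCount S l * (1 - r)⁻¹ ^ (freeCount S l + 1) * δ := by
  have hA : 1 ≤ (1 - r)⁻¹ := (one_le_inv₀ (by linarith)).2 (by linarith)
  induction l with
  | nil => intro S _ _ _; simp [prodAlong, freeCount]
  | cons w l ih =>
    intro S hX hY hXY
    by_cases hw : w ∈ S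
    · rw [freeCount_cons_of_mem hw]
      simpa [prodAlong, hw] using ih S (fun T u hT hu hl => hX T u hT hu (by simp [hl]))
        (fun T u hT hu hl => hY T u hT hu (by simp [hl]))
        (fun T u hT hu hl => hXY T u hT hu (by simp [hl]))
    · rw [freeCount_cons_of_notMem hw]
      simp only [prodAlong, hw, if_false, mul_inv]
      have hsub := Finset.subset_insert w S
      have hX' : ∀ T u, insert w S ⊆ T → u ∉ T → u ∈ l → ‖X T u‖ ≤ r :=
        fun T u hT hu hl => hX T u (hsub.trans hT) hu (by simp [hl])
      have hp := (norm_inv_prodAlong_le h0 h1 l (insert w S) hX').2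
      have hpq := ih (insert w S) hX'
        (fun T u hT hu hl => hY T u (hsub.trans hT) hu (by simp [hl]))
        (fun T u hT hu hl => hXY T u (hsub.trans hT) hu (by simp [hl]))
      obtain ⟨a0, a1⟩ := norm_inv_one_add_le h1 (hX S w subset_rfl hw (by simp))
      obtain ⟨b0, b1⟩ := norm_inv_one_add_le h1 (hY S w subset_rfl hw (by simp))
      have hd := hXY S w subset_rfl hw (by simp)
      have hm := freeCount_anti hsub l
      set A := (1 - r)⁻¹ with hAdef
      set m := freeCount S l
      set m' := freeCount (insert w S) l
      set p := (prodAlong X (insert w S) l)⁻¹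
      set q := (prodAlong Y (insert w S) l)⁻¹
      have hab : ‖(1 + X S w)⁻¹ - (1 + Y S w)⁻¹‖ ≤ A * δ * A := by
        have : (1 + X S w)⁻¹ - (1 + Y S w)⁻¹ =
            (1 + X S w)⁻¹ * (-(X S w - Y S w)) * (1 + Y S w)⁻¹ := by
          field_simp
          ring
        rw [this, norm_mul, norm_mul, norm_neg]
        gcongr
      have hp' : ‖p‖ ≤ A ^ m := hp.trans (pow_le_pow_right₀ hA hm)
      have hpq' : ‖p - q‖ ≤ m * A ^ (m + 1) * δ := by
        refine hpq.trans ?_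
        gcongr
      calc ‖(1 + X S w)⁻¹ * p - (1 + Y S w)⁻¹ * q‖
          = ‖((1 + X S w)⁻¹ - (1 + Y S w)⁻¹) * p + (1 + Y S w)⁻¹ * (p - q)‖ := by ring_nf
        _ ≤ ‖(1 + X S w)⁻¹ - (1 + Y S w)⁻¹‖ * ‖p‖ + ‖(1 + Y S w)⁻¹‖ * ‖p - q‖ := by
            refine (norm_add_le _ _).trans ?_
            rw [norm_mul, norm_mul]
        _ ≤ A * δ * A * A ^ m + A * (m * A ^ (m + 1) * δ) := by gcongr
        _ = ((m + 1 : ℕ) : ℝ) * A ^ (m + 1 + 1) * δ := by push_cast; ring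

/-- Two products along a list with close factors differ by a factor close to `1`. -/
theorem prodAlong_eq_mul_exp (h1 : r < 1) {δ : ℝ} (hδr : δ / (1 - r) ≤ 1 / 2)
    (hY : ∀ T w, w ∉ T → ‖Y T w‖ ≤ r) (hXY : ∀ T w, w ∉ T → ‖X T w - Y T w‖ ≤ δ) (hδ : 0 ≤ δ)
    (l : List V) : ∀ S : Finset V,
    ∃ z : ℂ, prodAlong X S l = prodAlong Y S l * Complex.exp z ∧
      ‖z‖ ≤ l.length * (3 / 2 * (δ / (1 - r))) := by
  have hpos : 0 ≤ δ / (1 - r) := div_nonneg hδ (by linarith)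
  induction l with
  | nil => intro S; exact ⟨0, by simp [prodAlong]⟩
  | cons w l ih =>
    intro S
    by_cases hw : w ∈ S
    · obtain ⟨z, hz, hn⟩ := ih S
      refine ⟨z, by simpa [prodAlong, hw] using hz, hn.trans ?_⟩
      gcongr
      simp
    · obtain ⟨z, hz, hn⟩ := ih (insert w S)
      obtain ⟨b0, b1⟩ := norm_inv_one_add_le h1 (hY S w hw)
      set u := (X S w - Y S w) * (1 + Y S w)⁻¹ with hu
      have hun : ‖u‖ ≤ δ / (1 - r) := by
        rw [hu, norm_mul, div_eq_mul_inv]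
        exact mul_le_mul (hXY S w hw) b1 (norm_nonneg _) hδ
      have hfac : 1 + X S w = (1 + Y S w) * (1 + u) := by
        rw [hu]
        field_simp
        ring
      have hu1 : 1 + u ≠ 0 := (norm_inv_one_add_le (r := 1 / 2) (by norm_num) (hun.trans hδr)).1
      -- The logarithms of the quotients 1 + u of corresponding factors add up; 3/2 comes from |log
      -- (1 + u)| ≤ 3/2 |u| for |u| ≤ 1/2.
      refine ⟨Complex.log (1 + u) + z, ?_, ?_⟩
      · simp only [prodAlong, hw, if_false]
        rw [hz, hfac, Complex.exp_add, Complex.exp_log hu1]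
        ring
      · have hlog := Complex.norm_log_one_add_half_le_self (hun.trans hδr)
        refine (norm_add_le _ _).trans ?_
        simp only [List.length_cons]
        push_cast
        linarith

end ProdAlong

/-! ### Partition functions of subgraphs and their ratios -/

section Hardcore

variable {V : Type*} [Fintype V] [DecidableEq V]

open Classical in
/-- The value at `lam` of the independence polynomial of `G` with the vertices in `S` removed. -/
noncomputable def hardcoreSum (G : SimpleGraph V) (lam : ℂ) (S : Finset V) : ℂ :=
  ∑ I ∈ Finset.univ.filter (fun I : Finset V => G.IsIndepSet (I : Set V) ∧ Disjoint I S),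
    lam ^ I.card

theorem hardcoreSum_empty (G : SimpleGraph V) (lam : ℂ) :
    hardcoreSum G lam ∅ = G.independencePolynomial.eval lam := by
  classical
  unfold hardcoreSum SimpleGraph.independencePolynomial
  rw [Polynomial.eval_finsetSum]
  refine Finset.sum_congr ?_ fun I _ => by simp
  ext I
  simp

theorem hardcoreSum_univ (G : SimpleGraph V) (lam : ℂ) :
    hardcoreSum G lam Finset.univ = 1 := by
  classical
  unfold hardcoreSum
  rw [Finset.sum_eq_single ∅]
  · simp
  · intro I hI hne
    simp only [Finset.mem_filter] at hI
    exact absurd (by simpa [Finset.disjoint_left, Finset.eq_empty_iff_forall_notMem] using hI.2.2)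
      hne
  · intro h
    refine absurd ?_ h
    simp [SimpleGraph.isIndepSet_iff]

/-- Splitting the independent sets according to whether they contain `v`. -/
theorem hardcoreSum_eq_add (G : SimpleGraph V) (lam : ℂ) {S N : Finset V} {v : V} (hv : v ∉ S)
    (hN : ∀ w, w ∈ N ↔ G.Adj v w) :
    hardcoreSum G lam S =
      hardcoreSum G lam (insert v S) + lam * hardcoreSum G lam (insert v S ∪ N) := by
  classical
  unfold hardcoreSum
  rw [← Finset.sum_filter_not_add_sum_filter _ (fun I : Finset V => v ∈ I)]
  congr 1
  · apply Finset.sum_congr _ (fun _ _ => rfl)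
    ext I
    simp only [Finset.mem_filter, Finset.mem_univ, true_and, Finset.disjoint_insert_right]
    tauto
  · rw [Finset.mul_sum]
    refine Finset.sum_bij' (fun I _ => I.erase v) (fun I _ => insert v I) ?_ ?_ ?_ ?_ ?_
    · intro I hI
      simp only [Finset.mem_filter, Finset.mem_univ, true_and] at hI ⊢
      obtain ⟨⟨hind, hdis⟩, hvI⟩ := hI
      refine ⟨hind.mono (by simp), ?_⟩
      rw [Finset.disjoint_left] at hdis ⊢
      intro a ha hmem
      rw [Finset.mem_erase] at ha
      simp only [Finset.mem_union, Finset.mem_insert] at hmem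
      rcases hmem with (h | h) | h
      · exact ha.1 h
      · exact hdis ha.2 h
      · exact hind (by exact_mod_cast hvI) (by exact_mod_cast ha.2) (Ne.symm ha.1) ((hN a).1 h)
    · intro I hI
      simp only [Finset.mem_filter, Finset.mem_univ, true_and] at hI ⊢
      obtain ⟨hind, hdis⟩ := hI
      rw [Finset.disjoint_left] at hdis
      refine ⟨⟨?_, ?_⟩, Finset.mem_insert_self _ _⟩
      · rw [SimpleGraph.isIndepSet_iff, Finset.coe_insert, Set.pairwise_insert]
        refine ⟨hind, fun b hb _ => ?_⟩
        have hnot : ¬ G.Adj v b := fun hadj => hdis hb (by simp [hN, hadj])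
        exact ⟨hnot, fun h => hnot h.symm⟩
      · rw [Finset.disjoint_left]
        intro a ha haS
        rcases Finset.mem_insert.1 ha with rfl | ha
        · exact hv haS
        · exact hdis ha (by simp [haS])
    · intro I hI
      simp only [Finset.mem_filter] at hI
      exact Finset.insert_erase hI.2
    · intro I hI
      simp only [Finset.mem_filter, Finset.mem_univ, true_and] at hI
      refine Finset.erase_insert fun h => ?_
      exact (Finset.disjoint_left.1 hI.2 h) (by simp)
    · intro I hI
      simp only [Finset.mem_filter] at hI
      rw [← pow_succ', Finset.card_erase_add_one hI.2]

/-- The ratio of the contributions of the independent sets with and without `v`, in the graph with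
the vertices in `S` removed; `L v` lists the neighbours of `v`. -/
noncomputable def hardcoreRatio (G : SimpleGraph V) (lam : ℂ) (L : V → List V)
    (S : Finset V) (v : V) : ℂ :=
  lam * hardcoreSum G lam (insert v S ∪ (L v).toFinset) / hardcoreSum G lam (insert v S)

/-- Telescoping: removing the members of a list one after another. -/
theorem hardcoreSum_eq_prodAlong (G : SimpleGraph V) (lam : ℂ) {L : V → List V}
    (hL : ∀ v w, w ∈ L v ↔ G.Adj v w) (l : List V) :
    ∀ S : Finset V, (∀ T w, S ⊆ T → w ∉ T → hardcoreSum G lam (insert w T) ≠ 0) →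
    hardcoreSum G lam S =
      prodAlong (hardcoreRatio G lam L) S l * hardcoreSum G lam (S ∪ l.toFinset) := by
  induction l with
  | nil => intro S _; simp [prodAlong]
  | cons w l ih =>
    intro S h
    by_cases hw : w ∈ S
    · rw [ih S h]
      simp only [prodAlong, hw, if_true, List.toFinset_cons, Finset.union_insert]
      rw [Finset.insert_eq_of_mem (Finset.mem_union_left _ hw)]
    · have h0 := h S w subset_rfl hw
      rw [hardcoreSum_eq_add G lam (N := (L w).toFinset) hw (by simp [hL])]
      have h1 := ih (insert w S)
        (fun T u hT hu => h T u ((Finset.subset_insert _ _).trans hT) hu)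
      have h2 : S ∪ (w :: l).toFinset = insert w S ∪ l.toFinset := by
        simp [Finset.union_insert, Finset.insert_union]
      simp only [prodAlong, hw, if_false]
      rw [h2, mul_assoc, ← h1, hardcoreRatio]
      field_simp

/-- The hypotheses of the contraction argument: `L` gives adjacency lists of `G` of length at most
`Δ`, and `lam` has modulus at most `c * lambdaStar Δ`. -/
structure Subcritical (G : SimpleGraph V) (L : V → List V) (Δ : ℕ) (lam : ℂ) (c : ℝ) : Prop where
  mem_iff : ∀ v w, w ∈ L v ↔ G.Adj v w
  length_le : ∀ v, (L v).length ≤ Δ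
  two_le : 2 ≤ Δ
  norm_le : ‖lam‖ * Δ * (1 - (Δ : ℝ)⁻¹)⁻¹ ^ (Δ - 1) ≤ c
  lt_one : c < 1

/-! ### Invariant polydisc, absence of zeros, and contraction -/

namespace Subcritical

set_option linter.unusedSectionVars false

variable {G : SimpleGraph V} {L : V → List V} {Δ : ℕ} {lam : ℂ} {c : ℝ}
  {X Y : Finset V → V → ℂ} {S : Finset V} {v : V}

theorem inv_nonneg (_ : Subcritical G L Δ lam c) : (0 : ℝ) ≤ (Δ : ℝ)⁻¹ := by positivity

theorem inv_le_half (h : Subcritical G L Δ lam c) : (Δ : ℝ)⁻¹ ≤ 1 / 2 := by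
  rw [one_div]
  exact inv_anti₀ (by norm_num) (by exact_mod_cast h.two_le)

theorem inv_lt_one (h : Subcritical G L Δ lam c) : (Δ : ℝ)⁻¹ < 1 := by
  have := h.inv_le_half
  linarith

theorem one_le_base (h : Subcritical G L Δ lam c) : 1 ≤ (1 - (Δ : ℝ)⁻¹)⁻¹ :=
  (one_le_inv₀ (by linarith [h.inv_lt_one])).2 (by linarith [h.inv_nonneg])

theorem base_le_two (h : Subcritical G L Δ lam c) : (1 - (Δ : ℝ)⁻¹)⁻¹ ≤ 2 := by
  rw [inv_le_comm₀ (by linarith [h.inv_lt_one]) (by norm_num)]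
  have := h.inv_le_half
  norm_num at this ⊢
  linarith

theorem nonneg (h : Subcritical G L Δ lam c) : 0 ≤ c := by
  refine le_trans ?_ h.norm_le
  have := h.one_le_base
  positivity

theorem norm_mul_pow_le (h : Subcritical G L Δ lam c) {m : ℕ} (hm : m ≤ Δ - 1) :
    ‖lam‖ * (1 - (Δ : ℝ)⁻¹)⁻¹ ^ m ≤ c * (Δ : ℝ)⁻¹ := by
  have hΔ : (0 : ℝ) < Δ := by exact_mod_cast (by have := h.two_le; omega : 0 < Δ)
  have h1 := pow_le_pow_right₀ h.one_le_base hm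
  rw [← div_eq_mul_inv, le_div_iff₀ hΔ]
  calc ‖lam‖ * (1 - (Δ : ℝ)⁻¹)⁻¹ ^ m * Δ ≤ ‖lam‖ * (1 - (Δ : ℝ)⁻¹)⁻¹ ^ (Δ - 1) * Δ := by gcongr
    _ = ‖lam‖ * Δ * (1 - (Δ : ℝ)⁻¹)⁻¹ ^ (Δ - 1) := by ring
    _ ≤ c := h.norm_le

theorem norm_lam_le (h : Subcritical G L Δ lam c) : ‖lam‖ ≤ c * (Δ : ℝ)⁻¹ := by
  simpa using h.norm_mul_pow_le (m := 0) (by omega)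

theorem mul_inv_le (h : Subcritical G L Δ lam c) : c * (Δ : ℝ)⁻¹ ≤ (Δ : ℝ)⁻¹ :=
  mul_le_of_le_one_left h.inv_nonneg h.lt_one.le

/-- The parent v is itself an entry of the list of w and is already deleted. This is what keeps all
recursive calls in the case of at most Δ - 1 factors. -/
theorem freeCount_le (h : Subcritical G L Δ lam c) {T : Finset V} {w : V} (hvw : w ∈ L v)
    (hT : v ∈ T) : freeCount T (L w) ≤ Δ - 1 := by
  have h1 : v ∈ L w := (h.mem_iff w v).2 ((h.mem_iff v w).1 hvw).symm
  have h2 := freeCount_lt_length h1 hT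
  have h3 := h.length_le w
  omega

/-- A vertex that has lost a neighbour has a small ratio if its neighbours have. -/
theorem norm_div_prodAlong_le (h : Subcritical G L Δ lam c)
    (hX : ∀ T w, S ⊆ T → w ∉ T → w ∈ L v → ‖X T w‖ ≤ (Δ : ℝ)⁻¹)
    (hf : freeCount S (L v) ≤ Δ - 1) : ‖lam / prodAlong X S (L v)‖ ≤ (Δ : ℝ)⁻¹ := by
  have h1 := (norm_inv_prodAlong_le h.inv_nonneg h.inv_lt_one (L v) S hX).2
  rw [div_eq_mul_inv, norm_mul]
  refine (mul_le_mul_of_nonneg_left h1 (norm_nonneg _)).trans ?_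
  exact (h.norm_mul_pow_le hf).trans h.mul_inv_le

/-- At the root all Δ neighbours may be present. The extra factor (1 - 1/Δ)⁻¹ ≤ 2 spoils the bound
1/Δ but leaves 2c/Δ ≤ c < 1, which is enough to keep 1 + R away from zero. -/
theorem norm_div_prodAlong_le_of_root (h : Subcritical G L Δ lam c)
    (hX : ∀ T w, S ⊆ T → w ∉ T → w ∈ L v → ‖X T w‖ ≤ (Δ : ℝ)⁻¹) :
    ‖lam / prodAlong X S (L v)‖ ≤ c := by
  have h1 := (norm_inv_prodAlong_le h.inv_nonneg h.inv_lt_one (L v) S hX).2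
  have h2 := pow_le_pow_right₀ h.one_le_base
    ((freeCount_le_length S (L v)).trans (h.length_le v))
  have h3 : (1 - (Δ : ℝ)⁻¹)⁻¹ ^ Δ = (1 - (Δ : ℝ)⁻¹)⁻¹ ^ (Δ - 1) * (1 - (Δ : ℝ)⁻¹)⁻¹ := by
    rw [← pow_succ]
    congr 1
    have := h.two_le
    omega
  rw [div_eq_mul_inv, norm_mul]
  calc ‖lam‖ * ‖(prodAlong X S (L v))⁻¹‖
      ≤ ‖lam‖ * ((1 - (Δ : ℝ)⁻¹)⁻¹ ^ (Δ - 1) * (1 - (Δ : ℝ)⁻¹)⁻¹) := by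
        rw [← h3]
        exact mul_le_mul_of_nonneg_left (h1.trans h2) (norm_nonneg _)
    _ = (‖lam‖ * (1 - (Δ : ℝ)⁻¹)⁻¹ ^ (Δ - 1)) * (1 - (Δ : ℝ)⁻¹)⁻¹ := by ring
    _ ≤ (c * (Δ : ℝ)⁻¹) * 2 :=
        mul_le_mul (h.norm_mul_pow_le le_rfl) h.base_le_two (by linarith [h.one_le_base])
          (mul_nonneg h.nonneg h.inv_nonneg)
    _ ≤ c := by nlinarith [h.nonneg, h.inv_le_half]

/-- The contraction step. With Δ - 1 factors the Lipschitz constant is at most c; at the root a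
cruder constant does no harm, since it enters only once. -/
theorem norm_div_prodAlong_sub_le (h : Subcritical G L Δ lam c) {δ : ℝ} (hδ : 0 ≤ δ)
    (hX : ∀ T w, S ⊆ T → w ∉ T → w ∈ L v → ‖X T w‖ ≤ (Δ : ℝ)⁻¹)
    (hY : ∀ T w, S ⊆ T → w ∉ T → w ∈ L v → ‖Y T w‖ ≤ (Δ : ℝ)⁻¹)
    (hXY : ∀ T w, S ⊆ T → w ∉ T → w ∈ L v → ‖X T w - Y T w‖ ≤ δ) :
    (freeCount S (L v) ≤ Δ - 1 →
      ‖lam / prodAlong X S (L v) - lam / prodAlong Y S (L v)‖ ≤ c * δ) ∧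
    ‖lam / prodAlong X S (L v) - lam / prodAlong Y S (L v)‖ ≤ 4 * (c * δ) := by
  have h1 := norm_inv_prodAlong_sub_le h.inv_nonneg h.inv_lt_one hδ (L v) S hX hY hXY
  have hA := h.one_le_base
  have hA2 := h.base_le_two
  have hΔ : (1 : ℝ) ≤ Δ := by exact_mod_cast (by have := h.two_le; omega : 1 ≤ Δ)
  -- This identity turns the Lipschitz constant |λ| (Δ - 1) A^Δ into the quantity bounded by c.
  have hbase : ((Δ : ℝ) - 1) * (1 - (Δ : ℝ)⁻¹)⁻¹ = Δ := by
    have : (Δ : ℝ) - 1 ≠ 0 := by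
      have : (2 : ℝ) ≤ Δ := by exact_mod_cast h.two_le
      intro h0
      linarith
    have h2 : 1 - (Δ : ℝ)⁻¹ = (Δ - 1) / Δ := by field_simp
    rw [h2]
    field_simp
  have key := h.norm_le
  have hf' := (freeCount_le_length S (L v)).trans (h.length_le v)
  have h3 : lam / prodAlong X S (L v) - lam / prodAlong Y S (L v) =
      lam * ((prodAlong X S (L v))⁻¹ - (prodAlong Y S (L v))⁻¹) := by
    rw [div_eq_mul_inv, div_eq_mul_inv, mul_sub]
  rw [h3, norm_mul]
  set A := (1 - (Δ : ℝ)⁻¹)⁻¹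
  set m := freeCount S (L v)
  have h4 := mul_le_mul_of_nonneg_left h1 (norm_nonneg lam)
  refine ⟨fun hf => h4.trans ?_, h4.trans ?_⟩
  · have hm : (m : ℝ) ≤ Δ - 1 := by
      have : m + 1 ≤ Δ := by have := h.two_le; omega
      have : ((m + 1 : ℕ) : ℝ) ≤ Δ := by exact_mod_cast this
      push_cast at this
      linarith
    have hp : A ^ m ≤ A ^ (Δ - 1) := pow_le_pow_right₀ hA hf
    calc ‖lam‖ * (m * A ^ (m + 1) * δ) = ‖lam‖ * (m * A * A ^ m * δ) := by ring
      _ ≤ ‖lam‖ * ((Δ - 1) * A * A ^ (Δ - 1) * δ) := by gcongr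
      _ = ‖lam‖ * Δ * A ^ (Δ - 1) * δ := by rw [hbase]; ring
      _ ≤ c * δ := mul_le_mul_of_nonneg_right key hδ
  -- Here m may equal Δ, so up to two powers of A ≤ 2 are in excess; they produce the 4.
  · have hp : A ^ (m + 1) ≤ A ^ (Δ - 1) * 2 ^ 2 := by
      calc A ^ (m + 1) ≤ A ^ (Δ - 1 + 2) := pow_le_pow_right₀ hA (by have := h.two_le; omega)
        _ = A ^ (Δ - 1) * A ^ 2 := pow_add _ _ _
        _ ≤ A ^ (Δ - 1) * 2 ^ 2 := by gcongr
    have hm : (m : ℝ) ≤ Δ := by exact_mod_cast hf'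
    calc ‖lam‖ * (m * A ^ (m + 1) * δ) ≤ ‖lam‖ * (Δ * (A ^ (Δ - 1) * 2 ^ 2) * δ) := by gcongr
      _ = 4 * ((‖lam‖ * Δ * A ^ (Δ - 1)) * δ) := by ring
      _ ≤ 4 * (c * δ) := by gcongr

theorem norm_truncRatio_le (h : Subcritical G L Δ lam c) (d : ℕ) :
    ∀ S v, freeCount (insert v S) (L v) ≤ Δ - 1 → ‖truncRatio lam L d S v‖ ≤ (Δ : ℝ)⁻¹ := by
  induction d with
  | zero => exact fun _ _ _ => h.norm_lam_le.trans h.mul_inv_le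
  | succ d ih =>
    intro S v hf
    refine h.norm_div_prodAlong_le (fun T w hT _ hw => ih T w ?_) hf
    exact h.freeCount_le hw (Finset.mem_insert_of_mem (hT (Finset.mem_insert_self _ _)))

theorem norm_truncRatio_le_of_root (h : Subcritical G L Δ lam c) (d : ℕ) (S : Finset V) (v : V) :
    ‖truncRatio lam L d S v‖ ≤ c := by
  cases d with
  | zero =>
    refine h.norm_lam_le.trans (mul_le_of_le_one_right h.nonneg h.inv_lt_one.le)
  | succ d =>
    refine h.norm_div_prodAlong_le_of_root (fun T w hT _ hw => h.norm_truncRatio_le d T w ?_)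
    exact h.freeCount_le hw (Finset.mem_insert_of_mem (hT (Finset.mem_insert_self _ _)))

/-- The recursion for the ratios, given that no partition function of a smaller graph vanishes. -/
theorem hardcoreRatio_eq (h : Subcritical G L Δ lam c)
    (hne : ∀ T, insert v S ⊆ T → hardcoreSum G lam T ≠ 0) :
    hardcoreRatio G lam L S v =
      lam / prodAlong (hardcoreRatio G lam L) (insert v S) (L v) := by
  have h1 := hardcoreSum_eq_prodAlong G lam h.mem_iff (L v) (insert v S)
    (fun T w hT _ => hne _ (hT.trans (Finset.subset_insert _ _)))
  have h2 := hne (insert v S ∪ (L v).toFinset) Finset.subset_union_left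
  have h3 := hne (insert v S) subset_rfl
  have h4 : prodAlong (hardcoreRatio G lam L) (insert v S) (L v) ≠ 0 := by
    intro h0
    rw [h0, zero_mul] at h1
    exact h3 h1
  rw [eq_div_iff h4]
  nth_rewrite 1 [hardcoreRatio]
  rw [div_mul_eq_mul_div, div_eq_iff h3, h1]
  ring

/-- Nonvanishing and the bounds on the ratios need each other, hence a joint induction on the number
of remaining vertices. The recursion for R(S,v) divides by partition functions of smaller graphs,
and Z(G - S) = Z(G - S - v) (1 + R(S,v)) with |R(S,v)| ≤ c < 1. -/
theorem hardcoreSum_ne_zero_and (h : Subcritical G L Δ lam c) (k : ℕ) :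
    ∀ S : Finset V, Sᶜ.card ≤ k → hardcoreSum G lam S ≠ 0 ∧
      ∀ v ∉ S, ‖hardcoreRatio G lam L S v‖ ≤ c ∧
        (freeCount (insert v S) (L v) ≤ Δ - 1 →
          ‖hardcoreRatio G lam L S v‖ ≤ (Δ : ℝ)⁻¹) := by
  induction k with
  | zero =>
    intro S hS
    have hS' : S = Finset.univ := by simpa using hS
    subst hS'
    exact ⟨by simp [hardcoreSum_univ], fun v hv => absurd (Finset.mem_univ v) hv⟩
  | succ k ih =>
    intro S hS
    have hlt : ∀ v, v ∉ S → ∀ T, insert v S ⊆ T → Tᶜ.card ≤ k := by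
      intro v hv T hT
      have h1 : S.card < T.card := Finset.card_lt_card
        ((Finset.ssubset_insert hv).trans_subset hT)
      rw [Finset.card_compl] at hS ⊢
      have := Finset.card_le_univ T
      omega
    have hratio : ∀ v ∉ S, ‖hardcoreRatio G lam L S v‖ ≤ c ∧
        (freeCount (insert v S) (L v) ≤ Δ - 1 →
          ‖hardcoreRatio G lam L S v‖ ≤ (Δ : ℝ)⁻¹) := by
      intro v hv
      have hX : ∀ T w, insert v S ⊆ T → w ∉ T → w ∈ L v →
          ‖hardcoreRatio G lam L T w‖ ≤ (Δ : ℝ)⁻¹ := fun T w hT hwT hw =>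
        ((ih T (hlt v hv T hT)).2 w hwT).2
          (h.freeCount_le hw (Finset.mem_insert_of_mem (hT (Finset.mem_insert_self _ _))))
      rw [h.hardcoreRatio_eq fun T hT => (ih T (hlt v hv T hT)).1]
      exact ⟨h.norm_div_prodAlong_le_of_root hX, h.norm_div_prodAlong_le hX⟩
    refine ⟨?_, hratio⟩
    rcases Sᶜ.eq_empty_or_nonempty with he | ⟨v, hv⟩
    · exact (ih S (by simp [he])).1
    · rw [Finset.mem_compl] at hv
      have h0 := (ih _ (hlt v hv (insert v S) subset_rfl)).1
      have h1 := (norm_inv_one_add_le h.lt_one (hratio v hv).1).1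
      have h2 := hardcoreSum_eq_add G lam (N := (L v).toFinset) hv (by simp [h.mem_iff])
      have h3 : hardcoreSum G lam S =
          hardcoreSum G lam (insert v S) * (1 + hardcoreRatio G lam L S v) := by
        rw [h2, hardcoreRatio]
        field_simp
      rw [h3]
      exact mul_ne_zero h0 h1

theorem hardcoreSum_ne_zero (h : Subcritical G L Δ lam c) (S : Finset V) :
    hardcoreSum G lam S ≠ 0 := (h.hardcoreSum_ne_zero_and _ S le_rfl).1

theorem norm_hardcoreRatio_le_of_root (h : Subcritical G L Δ lam c) (hv : v ∉ S) :
    ‖hardcoreRatio G lam L S v‖ ≤ c := ((h.hardcoreSum_ne_zero_and _ S le_rfl).2 v hv).1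

theorem norm_hardcoreRatio_le (h : Subcritical G L Δ lam c) (hv : v ∉ S)
    (hf : freeCount (insert v S) (L v) ≤ Δ - 1) :
    ‖hardcoreRatio G lam L S v‖ ≤ (Δ : ℝ)⁻¹ := ((h.hardcoreSum_ne_zero_and _ S le_rfl).2 v hv).2 hf

/-- Every recursive call falls under the first bound, so each level contributes a factor c, and the
4 is paid at the root alone. -/
theorem norm_hardcoreRatio_sub_le (h : Subcritical G L Δ lam c) (d : ℕ) :
    ∀ S v, v ∉ S → (freeCount (insert v S) (L v) ≤ Δ - 1 →
      ‖hardcoreRatio G lam L S v - truncRatio lam L d S v‖ ≤ c ^ d) ∧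
      ‖hardcoreRatio G lam L S v - truncRatio lam L d S v‖ ≤ 4 * c ^ d := by
  induction d with
  | zero =>
    intro S v hv
    have h1 := h.norm_lam_le
    have h2 := h.mul_inv_le
    have h3 := h.inv_le_half
    have h4 := h.lt_one
    simp only [truncRatio, pow_zero]
    refine ⟨fun hf => (norm_sub_le _ _).trans ?_, (norm_sub_le _ _).trans ?_⟩
    · linarith [h.norm_hardcoreRatio_le hv hf]
    · linarith [h.norm_hardcoreRatio_le_of_root hv]
  | succ d ih =>
    intro S v hv
    have hf : ∀ T w, insert v S ⊆ T → w ∈ L v → freeCount (insert w T) (L w) ≤ Δ - 1 :=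
      fun T w hT hw =>
        h.freeCount_le hw (Finset.mem_insert_of_mem (hT (Finset.mem_insert_self _ _)))
    rw [h.hardcoreRatio_eq fun T _ => h.hardcoreSum_ne_zero T, pow_succ', truncRatio]
    exact h.norm_div_prodAlong_sub_le (pow_nonneg h.nonneg d)
      (fun T w hT hwT hw => h.norm_hardcoreRatio_le hwT (hf T w hT hw))
      (fun T w hT hwT hw => h.norm_truncRatio_le d T w (hf T w hT hw))
      (fun T w hT hwT hw => (ih T w hwT).1 (hf T w hT hw))

theorem eval_eq_prodAlong_mul_exp (h : Subcritical G L Δ lam c) {l : List V}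
    (hl : ∀ v, v ∈ l) {d : ℕ} (hd : 4 * c ^ d / (1 - c) ≤ 1 / 2) :
    ∃ z : ℂ, G.independencePolynomial.eval lam =
        prodAlong (truncRatio lam L d) ∅ l * Complex.exp z ∧
      ‖z‖ ≤ l.length * (3 / 2 * (4 * c ^ d / (1 - c))) := by
  obtain ⟨z, hz, hn⟩ := prodAlong_eq_mul_exp (X := hardcoreRatio G lam L)
    (Y := truncRatio lam L d) h.lt_one hd (fun T w _ => h.norm_truncRatio_le_of_root d T w)
    (fun T w hw => (h.norm_hardcoreRatio_sub_le d T w hw).2)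
    (mul_nonneg (by norm_num) (pow_nonneg h.nonneg d)) l ∅
  refine ⟨z, ?_, hn⟩
  rw [← hz, ← hardcoreSum_empty, hardcoreSum_eq_prodAlong G lam h.mem_iff l ∅
    fun T w _ _ => h.hardcoreSum_ne_zero _]
  have : (∅ : Finset V) ∪ l.toFinset = Finset.univ := by
    ext v
    simp [hl]
  rw [this, hardcoreSum_univ, mul_one]

end Subcritical

end Hardcore

/-- The real part of z governs the quotient of the moduli and the imaginary part the angle. Capping
by 1 < π ensures that the imaginary part of z is the principal argument of exp z. -/
theorem isMultApprox_of_eq_mul_exp {ε : ℝ} {q ξ z : ℂ} (hq : q ≠ 0) (h : q = ξ * Complex.exp z)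
    (hz : ‖z‖ ≤ min ε 1) : IsMultApprox ε q ξ := by
  have hξ : ξ ≠ 0 := by
    rintro rfl
    simp [h] at hq
  have hnorm : ‖q‖ / ‖ξ‖ = Real.exp z.re := by
    rw [h, norm_mul, Complex.norm_exp]
    have := norm_ne_zero_iff.2 hξ
    field_simp
  have hre := abs_le.1 ((Complex.abs_re_le_norm z).trans (hz.trans (min_le_left _ _)))
  have him := abs_le.1 ((Complex.abs_im_le_norm z).trans (hz.trans (min_le_right _ _)))
  refine ⟨hq, hξ, ?_, ?_, ?_⟩
  · rw [hnorm]
    exact Real.exp_le_exp.2 hre.1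
  · rw [hnorm]
    exact Real.exp_le_exp.2 hre.2
  · rw [InnerProductGeometry.angle_comm, Complex.angle_eq_abs_arg hq hξ]
    have : q / ξ = Complex.exp z := by
      rw [h]
      field_simp
    have hpi := Real.pi_gt_three
    rw [this, ← Complex.log_im, Complex.log_exp (by linarith) (by linarith)]
    exact (Complex.abs_im_le_norm z).trans (hz.trans (min_le_left _ _))

/-- The threshold is where the recursion for the ratios stops contracting. -/
theorem lambdaStar_mul_eq_one {Δ : ℕ} (hΔ : 2 ≤ Δ) :
    lambdaStar Δ * Δ * (1 - (Δ : ℝ)⁻¹)⁻¹ ^ (Δ - 1) = 1 := by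
  obtain ⟨k, rfl⟩ : ∃ k, Δ = k + 1 := ⟨Δ - 1, by omega⟩
  have hk : (k : ℝ) ≠ 0 := by
    have : k ≠ 0 := by omega
    exact_mod_cast this
  have h1 : (k : ℝ) + 1 ≠ 0 := by positivity
  have h2 : 1 - ((k : ℝ) + 1)⁻¹ = k / (k + 1) := by field_simp; ring
  simp only [lambdaStar, Nat.add_sub_cancel]
  push_cast
  rw [h2, add_sub_cancel_right, inv_div, div_pow]
  field_simp
  ring

/-! ### Depth-first evaluation of the truncated recursion

The evaluation is carried out by a machine with a stack of frames, one for each vertex on the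
current branch of the recursion. Frames have identifiers; a vertex is removed from the graph if its
mark is the identifier of a frame that is still alive, so that all the vertices that a frame has
removed come back when the frame ends. -/

namespace DepthFirst

/-- The data that stay fixed during the evaluation: the adjacency lists, which stand one after
another in `adj` with the list of `v` beginning at `start v`, the highest level at which frames have
subordinate frames, and the parameter of the recursion. -/
structure Env where
  start : ℕ → ℕ
  adj : ℕ → ℕ
  depth : ℕ
  lam : ℂ

/-- The state of the evaluation. The frame at a level consists of the vertex `vert`, the part of
the adjacency list between `pos` and `fin` that is still to be treated, the identifier `ident`, and
the partial product `val`. -/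
structure Config where
  level : ℕ
  count : ℕ
  mark : ℕ → ℕ
  alive : ℕ → ℕ
  vert : ℕ → ℕ
  pos : ℕ → ℕ
  fin : ℕ → ℕ
  ident : ℕ → ℕ
  val : ℕ → ℂ

open Function (update)

/-- Opening a frame for the vertex `w`. -/
noncomputable def Config.push (e : Env) (σ : Config) (w : ℕ) : Config where
  level := σ.level + 1
  count := σ.count + 1
  mark := update σ.mark w (σ.count + 1)
  alive := update σ.alive (σ.count + 1) 1
  vert := update σ.vert (σ.level + 1) w
  pos := update σ.pos (σ.level + 1) (e.start w)
  fin := update σ.fin (σ.level + 1)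
    (if e.depth < σ.level + 1 then e.start w else e.start (w + 1))
  ident := update σ.ident (σ.level + 1) (σ.count + 1)
  val := update σ.val (σ.level + 1) 1

/-- Closing the top frame: its vertex is removed on behalf of the frame below, which gets another
factor. -/
noncomputable def Config.pop (e : Env) (σ : Config) : Config where
  level := σ.level - 1
  count := σ.count
  mark := update σ.mark (σ.vert σ.level) (σ.ident (σ.level - 1))
  alive := update σ.alive (σ.ident σ.level) 0
  vert := σ.vert
  pos := σ.pos
  fin := σ.fin
  ident := σ.ident
  val := update σ.val (σ.level - 1) (σ.val (σ.level - 1) * (1 + e.lam / σ.val σ.level))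

/-- Moving on in the adjacency list of the top frame. -/
def Config.advance (σ : Config) : Config :=
  { σ with pos := update σ.pos σ.level (σ.pos σ.level + 1) }

/-- One step of the evaluation; nothing happens when no frame is open. -/
noncomputable def Config.step (e : Env) (σ : Config) : Config :=
  if σ.level = 0 then σ
  else if σ.pos σ.level < σ.fin σ.level then
    if σ.alive (σ.mark (e.adj (σ.pos σ.level))) < 1 then
      σ.advance.push e (e.adj (σ.pos σ.level))
    else σ.advance
  else σ.pop e

/-- The invariants of the evaluation. -/
structure Config.Valid (σ : Config) : Prop where
  mark_le : ∀ u, σ.mark u ≤ σ.count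
  alive_eq : ∀ j, σ.count < j → σ.alive j = 0
  ident_le : σ.ident σ.level ≤ σ.count
  alive_ident : σ.alive (σ.ident σ.level) ≠ 0

/-- The vertices that are removed from the graph. -/
def Config.removed (n : ℕ) (σ : Config) : Finset (Fin n) :=
  Finset.univ.filter fun u => σ.alive (σ.mark u) ≠ 0

theorem Config.mem_removed {n : ℕ} {σ : Config} {u : Fin n} :
    u ∈ σ.removed n ↔ σ.alive (σ.mark u) ≠ 0 := by
  simp [removed]

/-- `σ'` arises from `σ` by work on behalf of the top frame of `σ`. -/
structure Config.Extends (σ σ' : Config) : Prop where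
  valid : σ'.Valid
  level_eq : σ'.level = σ.level
  count_le : σ.count ≤ σ'.count
  vert_eq : ∀ j ≤ σ.level, σ'.vert j = σ.vert j
  fin_eq : ∀ j ≤ σ.level, σ'.fin j = σ.fin j
  ident_eq : ∀ j ≤ σ.level, σ'.ident j = σ.ident j
  pos_eq : ∀ j < σ.level, σ'.pos j = σ.pos j
  val_eq : ∀ j < σ.level, σ'.val j = σ.val j
  alive_eq : ∀ j ≤ σ.count, σ'.alive j = σ.alive j
  alive_new : ∀ j, σ.count < j → σ'.alive j = 0
  mark_eq : ∀ u, σ.alive (σ.mark u) ≠ 0 → σ'.mark u = σ.mark u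
  mark_new : ∀ u, σ.alive (σ.mark u) = 0 →
    σ'.alive (σ'.mark u) = 0 ∨ σ'.mark u = σ.ident σ.level

/-! ### Bookkeeping of marks and frames -/

namespace Config

theorem Extends.trans {σ₁ σ₂ σ₃ : Config} (h : σ₁.Extends σ₂) (h' : σ₂.Extends σ₃)
    (h₁ : σ₁.Valid) : σ₁.Extends σ₃ where
  valid := h'.valid
  level_eq := h'.level_eq.trans h.level_eq
  count_le := h.count_le.trans h'.count_le
  vert_eq j hj := (h'.vert_eq j (h.level_eq ▸ hj)).trans (h.vert_eq j hj)
  fin_eq j hj := (h'.fin_eq j (h.level_eq ▸ hj)).trans (h.fin_eq j hj)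
  ident_eq j hj := (h'.ident_eq j (h.level_eq ▸ hj)).trans (h.ident_eq j hj)
  pos_eq j hj := (h'.pos_eq j (h.level_eq ▸ hj)).trans (h.pos_eq j hj)
  val_eq j hj := (h'.val_eq j (h.level_eq ▸ hj)).trans (h.val_eq j hj)
  alive_eq j hj := (h'.alive_eq j (hj.trans h.count_le)).trans (h.alive_eq j hj)
  alive_new j hj := by
    rcases lt_or_ge σ₂.count j with hlt | hle
    · exact h'.alive_new j hlt
    · rw [h'.alive_eq j hle, h.alive_new j hj]
  mark_eq u hu := by
    have h2 := h.mark_eq u hu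
    rw [← h2]
    refine h'.mark_eq u ?_
    rwa [h2, h.alive_eq _ (h₁.mark_le u)]
  mark_new u hu := by
    have hid := h.ident_eq _ le_rfl
    rcases h.mark_new u hu with h2 | h2
    · have := h'.mark_new u h2
      rwa [h.level_eq, hid] at this
    · right
      rw [← h2]
      refine h'.mark_eq u ?_
      rw [h2, h.alive_eq _ h₁.ident_le]
      exact h₁.alive_ident

theorem Valid.advance {σ : Config} (h : σ.Valid) : σ.Extends σ.advance where
  valid := ⟨h.mark_le, h.alive_eq, h.ident_le, h.alive_ident⟩
  level_eq := rfl
  count_le := le_rfl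
  vert_eq _ _ := rfl
  fin_eq _ _ := rfl
  ident_eq _ _ := rfl
  pos_eq _ hj := Function.update_of_ne hj.ne _ _
  val_eq _ _ := rfl
  alive_eq _ _ := rfl
  alive_new := h.alive_eq
  mark_eq _ _ := rfl
  mark_new _ hu := Or.inl hu

theorem Valid.push {σ : Config} (h : σ.Valid) (e : Env) (w : ℕ) : (σ.push e w).Valid where
  mark_le u := by
    simp only [Config.push, Function.update_apply]
    split_ifs
    · exact le_rfl
    · exact (h.mark_le u).trans (Nat.le_succ _)
  alive_eq j hj := by
    simp only [Config.push] at hj ⊢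
    rw [Function.update_of_ne (by omega)]
    exact h.alive_eq j (by omega)
  ident_le := by simp [Config.push]
  alive_ident := by simp [Config.push]

/-- The new identifier exceeds every mark in use, so bringing it to life affects no vertex other
than w. -/
theorem Valid.removed_push {n : ℕ} {σ : Config} (h : σ.Valid) (e : Env) (w : Fin n) :
    (σ.push e w).removed n = insert w (σ.removed n) := by
  ext u
  rw [Finset.mem_insert, mem_removed, mem_removed]
  by_cases hu : u = w
  · simp [hu, Config.push]
  · have h1 : (u : ℕ) ≠ w := fun h' => hu (Fin.ext h')
    have h2 := h.mark_le u
    simp only [Config.push, Function.update_of_ne h1, hu, false_or]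
    rw [Function.update_of_ne (by omega)]

/-- Work inside a frame for a vertex that was not removed, and closing it. -/
theorem Valid.extends_pop {σ σ' : Config} (h : σ.Valid) (e : Env) {w : ℕ}
    (hw : σ.alive (σ.mark w) = 0) (h' : (σ.push e w).Extends σ') :
    σ.Extends (σ'.pop e) ∧ (σ'.pop e).pos σ.level = σ.pos σ.level ∧
      (σ'.pop e).val σ.level = σ.val σ.level * (1 + e.lam / σ'.val (σ.level + 1)) ∧
      (σ'.pop e).mark w = σ.ident σ.level ∧
      ∀ u ≠ w, σ.alive (σ.mark u) = 0 → (σ'.pop e).alive ((σ'.pop e).mark u) = 0 := by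
  have hlev : σ'.level = σ.level + 1 := h'.level_eq
  have hcount : σ.count + 1 ≤ σ'.count := h'.count_le
  have hlow : ∀ j ≤ σ.level, j ≠ σ.level + 1 := fun j hj => by omega
  have hvert : ∀ j ≤ σ.level, σ'.vert j = σ.vert j := fun j hj => by
    rw [h'.vert_eq j (by simp only [Config.push]; omega)]
    exact Function.update_of_ne (hlow j hj) _ _
  have hfin : ∀ j ≤ σ.level, σ'.fin j = σ.fin j := fun j hj => by
    rw [h'.fin_eq j (by simp only [Config.push]; omega)]
    exact Function.update_of_ne (hlow j hj) _ _
  have hident : ∀ j ≤ σ.level, σ'.ident j = σ.ident j := fun j hj => by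
    rw [h'.ident_eq j (by simp only [Config.push]; omega)]
    exact Function.update_of_ne (hlow j hj) _ _
  have hpos : ∀ j ≤ σ.level, σ'.pos j = σ.pos j := fun j hj => by
    rw [h'.pos_eq j (by simp only [Config.push]; omega)]
    exact Function.update_of_ne (hlow j hj) _ _
  have hval : ∀ j ≤ σ.level, σ'.val j = σ.val j := fun j hj => by
    rw [h'.val_eq j (by simp only [Config.push]; omega)]
    exact Function.update_of_ne (hlow j hj) _ _
  have hvw : σ'.vert σ'.level = w := by
    rw [hlev, h'.vert_eq _ (by simp [Config.push])]
    simp [Config.push]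
  have hid : σ'.ident σ'.level = σ.count + 1 := by
    rw [hlev, h'.ident_eq _ (by simp [Config.push])]
    simp [Config.push]
  have halive : ∀ j ≤ σ.count, σ'.alive j = σ.alive j := fun j hj => by
    rw [h'.alive_eq j (by simp only [Config.push]; omega)]
    exact Function.update_of_ne (by omega) _ _
  have hnew : ∀ j, σ.count < j → update σ'.alive (σ.count + 1) 0 j = 0 := fun j hj => by
    rcases eq_or_ne j (σ.count + 1) with rfl | hne
    · simp
    · rw [Function.update_of_ne hne]
      exact h'.alive_new j (by simp only [Config.push]; omega)
  have hold : ∀ j ≤ σ.count, update σ'.alive (σ.count + 1) 0 j = σ.alive j := fun j hj => by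
    rw [Function.update_of_ne (by omega), halive j hj]
  have hmark : ∀ u, σ.alive (σ.mark u) ≠ 0 → update σ'.mark w (σ.ident σ.level) u = σ.mark u := by
    intro u hu
    have hne : u ≠ w := by
      rintro rfl
      exact hu hw
    rw [Function.update_of_ne hne]
    have h2 : (σ.push e w).mark u = σ.mark u := Function.update_of_ne hne _ _
    rw [← h2]
    refine h'.mark_eq u ?_
    have h3 := h.mark_le u
    rw [h2]
    simp only [Config.push]
    rwa [Function.update_of_ne (by omega)]
  have hmarkw : (σ'.pop e).mark w = σ.ident σ.level := by
    simp only [Config.pop, hvw, Function.update_self]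
    rw [hlev, Nat.add_sub_cancel, hident _ le_rfl]
  have hdead : ∀ u ≠ w, σ.alive (σ.mark u) = 0 →
      (σ'.pop e).alive ((σ'.pop e).mark u) = 0 := by
    intro u hne hu
    simp only [Config.pop, hvw, hid]
    rw [Function.update_of_ne hne]
    have h2 : (σ.push e w).mark u = σ.mark u := Function.update_of_ne hne _ _
    have h3 := h.mark_le u
    have h4 : (σ.push e w).alive ((σ.push e w).mark u) = 0 := by
      rw [h2]
      simp only [Config.push]
      rwa [Function.update_of_ne (by omega)]
    -- Either u is still free when the frame ends, or it was removed on behalf of that frame, whose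
    -- identifier dies with it.
    rcases h'.mark_new u h4 with h5 | h5
    · by_cases h6 : σ'.mark u = σ.count + 1
      · simp [h6]
      · rwa [Function.update_of_ne h6]
    · rw [h5]
      simp [Config.push]
  refine ⟨?_, ?_, ?_, hmarkw, hdead⟩
  · refine ⟨⟨?_, ?_, ?_, ?_⟩, ?_, ?_, ?_, ?_, ?_, ?_, ?_, ?_, ?_, ?_, ?_⟩
    · intro u
      simp only [Config.pop, Function.update_apply]
      split_ifs
      · rw [hlev, Nat.add_sub_cancel, hident _ le_rfl]
        have := h.ident_le
        omega
      · exact h'.valid.mark_le u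
    · intro j hj
      simp only [Config.pop, hid] at hj ⊢
      exact hnew j (by omega)
    · simp only [Config.pop, hlev, Nat.add_sub_cancel, hident _ le_rfl]
      have := h.ident_le
      omega
    · simp only [Config.pop, hid]
      rw [hlev, Nat.add_sub_cancel, hident _ le_rfl, hold _ h.ident_le]
      exact h.alive_ident
    · simp [Config.pop, hlev]
    · simp only [Config.pop]
      omega
    · exact hvert
    · exact hfin
    · exact hident
    · exact fun j hj => hpos j hj.le
    · intro j hj
      simp only [Config.pop]
      rw [Function.update_of_ne (by omega), hval j hj.le]
    · intro j hj
      simp only [Config.pop, hid]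
      exact hold j hj
    · intro j hj
      simp only [Config.pop, hid]
      exact hnew j hj
    · intro u hu
      simp only [Config.pop, hvw]
      rw [hlev, Nat.add_sub_cancel, hident _ le_rfl, hmark u hu]
    · intro u hu
      rcases eq_or_ne u w with rfl | hne
      · exact Or.inr hmarkw
      · exact Or.inl (hdead u hne hu)
  · exact hpos _ le_rfl
  · simp [Config.pop, hlev, hval]

/-- After its frame is closed, w stays deleted for its later siblings while all deletions made
inside the frame are undone. This is exactly the passage from S to `insert w S` in `prodAlong`. -/
theorem Valid.removed_eq_insert {n : ℕ} {σ σ' : Config} (h : σ.Valid) {w : Fin n}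
    (h' : σ.Extends σ') (hw : σ'.mark w = σ.ident σ.level)
    (hdead : ∀ u ≠ (w : ℕ), σ.alive (σ.mark u) = 0 → σ'.alive (σ'.mark u) = 0) :
    σ'.removed n = insert w (σ.removed n) := by
  ext u
  rw [Finset.mem_insert, mem_removed, mem_removed]
  rcases eq_or_ne u w with rfl | hne
  · simp only [true_or, iff_true, hw]
    rw [h'.alive_eq _ h.ident_le]
    exact h.alive_ident
  · have h1 : (u : ℕ) ≠ w := fun h' => hne (Fin.ext h')
    simp only [hne, false_or]
    constructor
    · exact fun h2 h3 => h2 (hdead u h1 h3)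
    · intro h2
      rw [h'.mark_eq u h2, h'.alive_eq _ (h.mark_le u)]
      exact h2

end Config

/-- The environment holds the adjacency lists `L`. -/
def Env.Holds {n : ℕ} (e : Env) (L : Fin n → List (Fin n)) : Prop :=
  ∀ v : Fin n, e.start (v + 1) = e.start v + (L v).length ∧
    ∀ (i : ℕ) (h : i < (L v).length), e.adj (e.start v + i) = (L v)[i]

open Config

/-- The part `l` of the adjacency list of the top frame that is still to be treated. -/
def Config.Pending {n : ℕ} (e : Env) (σ : Config) (l : List (Fin n)) : Prop :=
  σ.fin σ.level = σ.pos σ.level + l.length ∧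
    ∀ (i : ℕ) (h : i < l.length), e.adj (σ.pos σ.level + i) = l[i]

/-- What the evaluation of the frame of `w`, opened on top of `σ`, has to achieve within `T` steps
if the truncated ratio is `x`. -/
def Evaluates {n : ℕ} (e : Env) (σ : Config) (w : Fin n) (x : ℂ) (T : ℕ) : Prop :=
  ∃ k ≤ T, ∃ σ', (step e)^[k] (σ.push e w) = σ' ∧ σ.Extends σ' ∧
    σ'.pos σ.level = σ.pos σ.level ∧ σ'.val σ.level = σ.val σ.level * (1 + x) ∧
    σ'.removed n = insert w (σ.removed n)

/-- Treating the remaining part of the adjacency list of the top frame. -/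
theorem exists_iterate_of_pending {n : ℕ} {e : Env} {X : Finset (Fin n) → Fin n → ℂ} {T ℓ : ℕ}
    (hℓ : ℓ ≠ 0)
    (hX : ∀ (σ : Config) (w : Fin n), σ.Valid → σ.level = ℓ → w ∉ σ.removed n →
      Evaluates e σ w (X (σ.removed n) w) T) (l : List (Fin n)) :
    ∀ σ : Config, σ.Valid → σ.level = ℓ → σ.Pending e l →
    ∃ k ≤ l.length * (T + 1), ∃ σ', (step e)^[k] σ = σ' ∧ σ.Extends σ' ∧
      σ'.pos ℓ = σ'.fin ℓ ∧ σ'.val ℓ = σ.val ℓ * prodAlong X (σ.removed n) l := by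
  induction l with
  | nil =>
    intro σ hσ hlev hp
    refine ⟨0, by simp, σ, rfl, ?_, ?_, by simp [prodAlong]⟩
    · exact ⟨hσ, rfl, le_rfl, fun _ _ => rfl, fun _ _ => rfl, fun _ _ => rfl, fun _ _ => rfl,
        fun _ _ => rfl, fun _ _ => rfl, hσ.alive_eq, fun _ _ => rfl, fun _ h => Or.inl h⟩
    · have := hp.1
      rw [hlev] at this
      simpa using this.symm
  | cons w l ih =>
    intro σ hσ hlev hp
    have hlt : σ.pos σ.level < σ.fin σ.level := by
      rw [hp.1]
      simp
    have hw : e.adj (σ.pos σ.level) = w := hp.2 0 (by simp)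
    have hadv := hσ.advance
    have hrem : σ.advance.removed n = σ.removed n := rfl
    have hpadv : σ.advance.Pending e l := by
      constructor
      · have := hp.1
        simp only [advance, Function.update_self, List.length_cons] at this ⊢
        omega
      · intro i hi
        have := hp.2 (i + 1) (by simpa using hi)
        simp only [advance, Function.update_self]
        rw [add_assoc, add_comm 1 i]
        simpa using this
    by_cases hmem : w ∈ σ.removed n
    · have hstep : step e σ = σ.advance := by
        have : ¬ σ.alive (σ.mark w) < 1 := by
          have := mem_removed.1 hmem
          omega
        rw [step, if_neg (hlev ▸ hℓ), if_pos hlt, hw, if_neg this]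
      obtain ⟨k, hk, σ', hiter, hext, hpos, hval⟩ := ih σ.advance hadv.valid hlev hpadv
      refine ⟨k + 1, ?_, σ', ?_, hadv.trans hext hσ, hpos, ?_⟩
      · simp only [List.length_cons]
        nlinarith
      · rw [Function.iterate_succ_apply, hstep, hiter]
      · rw [hval, hrem]
        simp [prodAlong, hmem, advance]
    · have hstep : step e σ = σ.advance.push e w := by
        have : σ.alive (σ.mark w) < 1 := by
          have := mt mem_removed.2 hmem
          omega
        rw [step, if_neg (hlev ▸ hℓ), if_pos hlt, hw, if_pos this]
      obtain ⟨k₁, hk₁, σ₁, hiter₁, hext₁, hpos₁, hval₁, hrem₁⟩ :=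
        hX σ.advance w hadv.valid hlev (by rwa [hrem])
      have hlev₁ : σ₁.level = ℓ := hext₁.level_eq.trans hlev
      have hp₁ : σ₁.Pending e l := by
        have h1 := hext₁.fin_eq _ le_rfl
        unfold Pending
        rw [hext₁.level_eq, h1, hpos₁]
        exact hpadv
      obtain ⟨k, hk, σ', hiter, hext, hpos, hval⟩ := ih σ₁ hext₁.valid hlev₁ hp₁
      refine ⟨k + (k₁ + 1), ?_, σ', ?_, (hadv.trans hext₁ hσ).trans hext hσ, hpos, ?_⟩
      · simp only [List.length_cons]
        nlinarith
      · rw [Function.iterate_add_apply, Function.iterate_succ_apply, hstep, hiter₁, hiter]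
      · have : σ₁.val ℓ = σ.val ℓ * (1 + X (σ.removed n) w) := by
          rw [← hlev]
          exact hval₁
        rw [hval, this, hrem₁, hrem]
        simp [prodAlong, hmem, mul_assoc]

/-- Induction on the remaining depth: the frame of w treats its neighbours by the induction
hypothesis, and closing it multiplies the value below by 1 + λ / (its product). -/
theorem evaluates_truncRatio {n Δ : ℕ} {e : Env} {L : Fin n → List (Fin n)} (he : e.Holds L)
    (hΔ : ∀ v, (L v).length ≤ Δ) (d : ℕ) :
    ∀ (σ : Config) (w : Fin n), σ.Valid → σ.level + d = e.depth → w ∉ σ.removed n →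
      Evaluates e σ w (truncRatio e.lam L d (σ.removed n) w) ((Δ + 1) * (Δ + 1) ^ d) := by
  induction d with
  | zero =>
    intro σ w hσ hlev hw
    have hw0 : σ.alive (σ.mark w) = 0 := by
      have := mt mem_removed.2 hw
      omega
    have hpush := hσ.push e w
    have hself : (σ.push e w).Extends (σ.push e w) :=
      ⟨hpush, rfl, le_rfl, fun _ _ => rfl, fun _ _ => rfl, fun _ _ => rfl, fun _ _ => rfl,
        fun _ _ => rfl, fun _ _ => rfl, hpush.alive_eq, fun _ _ => rfl, fun _ h => Or.inl h⟩
    obtain ⟨h1, h2, h3, h4, h5⟩ := hσ.extends_pop e hw0 hself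
    refine ⟨1, by simp, (σ.push e w).pop e, ?_, h1, h2, ?_, hσ.removed_eq_insert h1 h4 h5⟩
    -- Beyond the maximal level a frame gets an empty list. It is closed at once with product 1 and
    -- contributes the truncated value λ.
    · have : e.depth < σ.level + 1 := by omega
      simp [step, Config.push, this]
    · rw [h3]
      simp [Config.push, truncRatio]
  | succ d ih =>
    intro σ w hσ hlev hw
    have hw0 : σ.alive (σ.mark w) = 0 := by
      have := mt mem_removed.2 hw
      omega
    have hpush := hσ.push e w
    have hpend : (σ.push e w).Pending e (L w) := by
      have hd : ¬ e.depth < σ.level + 1 := by omega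
      obtain ⟨h1, h2⟩ := he w
      constructor
      · simp [Config.push, hd, h1]
      · intro i hi
        simpa [Config.push] using h2 i hi
    obtain ⟨k, hk, σ', hiter, hext, hpos, hval⟩ :=
      exists_iterate_of_pending (e := e) (X := truncRatio e.lam L d) (ℓ := σ.level + 1)
        (Nat.succ_ne_zero _)
        (fun τ u hτ hτl hu => ih τ u hτ (by omega) hu) (L w) (σ.push e w) hpush rfl hpend
    obtain ⟨h1, h2, h3, h4, h5⟩ := hσ.extends_pop e hw0 hext
    refine ⟨1 + k, ?_, σ'.pop e, ?_, h1, h2, ?_, hσ.removed_eq_insert h1 h4 h5⟩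
    -- The step bound T satisfies T(d+1) ≥ 1 + Δ (T(d) + 1): one step closes the frame, and each
    -- list entry takes one step besides its own evaluation.
    · have hT : 1 ≤ (Δ + 1) ^ d := Nat.one_le_pow _ _ (by omega)
      have hl := Nat.mul_le_mul_right ((Δ + 1) * (Δ + 1) ^ d + 1) (hΔ w)
      calc 1 + k ≤ 1 + Δ * ((Δ + 1) * (Δ + 1) ^ d + 1) := by omega
        _ = Δ * ((Δ + 1) * (Δ + 1) ^ d) + (Δ + 1) * 1 := by ring
        _ ≤ Δ * ((Δ + 1) * (Δ + 1) ^ d) + (Δ + 1) * (Δ + 1) ^ d := by gcongr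
        _ = (Δ + 1) * (Δ + 1) ^ (d + 1) := by ring
    · have hlev' : σ'.level = σ.level + 1 := hext.level_eq
      rw [Function.iterate_add_apply, hiter]
      simp [step, hlev', hpos]
    · rw [h3, hval, hσ.removed_push e w]
      simp [Config.push, truncRatio]

end DepthFirst

/-! ### Programs without loops -/

namespace RealRAM

open Classical in
/-- The effect of a program without loops. -/
noncomputable def Program.eval : Program → Store → Store
  | .skip, s => s
  | .instr i, s => i.run s
  | .seq p q, s => q.eval (p.eval s)
  | .ite c p q, s => if c.Holds s then p.eval s else q.eval s
  | .while _ _, s => s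

/-- A bound for the number of steps of a program without loops. -/
def Program.cost : Program → ℕ
  | .skip => 0
  | .instr _ => 1
  | .seq p q => p.cost + q.cost
  | .ite _ p q => p.cost + q.cost + 1
  | .while _ _ => 0

/-- The program contains no loop. -/
def Program.LoopFree : Program → Prop
  | .skip => True
  | .instr _ => True
  | .seq p q => p.LoopFree ∧ q.LoopFree
  | .ite _ p q => p.LoopFree ∧ q.LoopFree
  | .while _ _ => False

/-- The program halts on `s` in `s'` after at most `T` steps. -/
def Runs (p : Program) (s s' : Store) (T : ℕ) : Prop := ∃ t ≤ T, Exec p s s' t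

theorem Program.LoopFree.runs {p : Program} (h : p.LoopFree) (s : Store) :
    Runs p s (p.eval s) p.cost := by
  induction p generalizing s with
  | skip => exact ⟨0, le_rfl, .skip s⟩
  | instr i => exact ⟨1, le_rfl, .instr i s⟩
  | seq p q hp hq =>
    obtain ⟨t, ht, ht'⟩ := hp h.1 s
    obtain ⟨u, hu, hu'⟩ := hq h.2 (p.eval s)
    exact ⟨t + u, Nat.add_le_add ht hu, .seq ht' hu'⟩
  | ite c p q hp hq =>
    by_cases hc : c.Holds s
    · obtain ⟨t, ht, ht'⟩ := hp h.1 s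
      refine ⟨t + 1, by simp only [Program.cost]; omega, ?_⟩
      simpa [Program.eval, hc] using Exec.iteTrue hc ht'
    · obtain ⟨t, ht, ht'⟩ := hq h.2 s
      refine ⟨t + 1, by simp only [Program.cost]; omega, ?_⟩
      simpa [Program.eval, hc] using Exec.iteFalse hc ht'
  | _ => exact h.elim

theorem Runs.seq {p q : Program} {s₁ s₂ s₃ : Store} {T₁ T₂ : ℕ} (h : Runs p s₁ s₂ T₁)
    (h' : Runs q s₂ s₃ T₂) : Runs (.seq p q) s₁ s₃ (T₁ + T₂) := by
  obtain ⟨t, ht, ht'⟩ := h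
  obtain ⟨u, hu, hu'⟩ := h'
  exact ⟨t + u, Nat.add_le_add ht hu, .seq ht' hu'⟩

theorem Runs.while_of_not {c : Test} {p : Program} {s : Store} (h : ¬ c.Holds s) :
    Runs (.while c p) s s 1 := ⟨1, le_rfl, .whileFalse h⟩

theorem Runs.while_of {c : Test} {p : Program} {s₁ s₂ s₃ : Store} {T₁ T₂ : ℕ} (h : c.Holds s₁)
    (h₁ : Runs p s₁ s₂ T₁) (h₂ : Runs (.while c p) s₂ s₃ T₂) :
    Runs (.while c p) s₁ s₃ (T₁ + T₂ + 1) := by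
  obtain ⟨t, ht, ht'⟩ := h₁
  obtain ⟨u, hu, hu'⟩ := h₂
  exact ⟨t + u + 1, by omega, .whileTrue h ht' hu'⟩

theorem Runs.mono {p : Program} {s s' : Store} {T T' : ℕ} (h : Runs p s s' T) (hT : T ≤ T') :
    Runs p s s' T' := by
  obtain ⟨t, ht, ht'⟩ := h
  exact ⟨t, ht.trans hT, ht'⟩

/-- Elementary operations one after another. -/
def Program.block : List Instr → Program
  | [] => .skip
  | i :: l => .seq (.instr i) (Program.block l)

theorem Program.loopFree_block (l : List Instr) : (Program.block l).LoopFree := by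
  induction l with
  | nil => trivial
  | cons i l ih => exact ⟨trivial, ih⟩

end RealRAM

/-! ### The evaluation as a program -/

namespace DepthFirst

open RealRAM RealRAM.Program RealRAM.Instr

/-- The program that opens a frame for the vertex in natural register `6`. -/
def pushProgram : Program :=
  .seq (block [natAdd 1 1 4, natAdd 2 2 4, natStore 2 6 2, natStore 3 2 4, natStore 4 1 6,
      natStore 7 1 2, natLoad 7 0 6, natStore 5 1 7, natAdd 9 6 4, natLoad 9 0 9])
    (.seq (.ite (.natLt 3 1) (block [natCopy 9 7]) .skip)
      (block [natStore 6 1 9, realConst 3 1, realConst 4 0, realStore 0 1 3, realStore 1 1 4]))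

/-- The program that closes the top frame. -/
def popProgram : Program :=
  block [natLoad 7 7 1, natStore 3 7 8, natLoad 6 4 1, realLoad 3 0 1, realLoad 4 1 1,
    natSub 1 1 4, natLoad 7 7 1, natStore 2 6 7,
    realMul 5 3 3, realMul 6 4 4, realAdd 5 5 6,
    realMul 6 1 3, realMul 7 2 4, realAdd 6 6 7, realDiv 6 6 5,
    realMul 7 2 3, realMul 8 1 4, realSub 7 7 8, realDiv 7 7 5,
    realConst 8 1, realAdd 6 6 8, realLoad 3 0 1, realLoad 4 1 1,
    realMul 5 3 6, realMul 8 4 7, realSub 5 5 8, realStore 0 1 5,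
    realMul 5 3 7, realMul 8 4 6, realAdd 5 5 8, realStore 1 1 5]

/-- The program for one step of the evaluation. -/
def stepProgram : Program :=
  .seq (block [natLoad 7 5 1, natLoad 9 6 1])
    (.ite (.natLt 7 9)
      (.seq (block [natLoad 6 1 7, natAdd 7 7 4, natStore 5 1 7, natLoad 9 2 6, natLoad 9 3 9])
        (.ite (.natLt 9 4) pushProgram .skip))
      popProgram)

/-- The memory `s` represents the state `σ` of the evaluation; natural registers `0` and `5` hold
`n` and `i`. -/
structure Represents (e : Env) (n i : ℕ) (σ : Config) (s : Store) : Prop where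
  size : s.natReg 0 = n
  level : s.natReg 1 = σ.level
  count : s.natReg 2 = σ.count
  depth : s.natReg 3 = e.depth
  one : s.natReg 4 = 1
  index : s.natReg 5 = i
  zero : s.natReg 8 = 0
  start : s.natArr 0 = e.start
  adj : s.natArr 1 = e.adj
  mark : s.natArr 2 = σ.mark
  alive : s.natArr 3 = σ.alive
  vert : s.natArr 4 = σ.vert
  pos : s.natArr 5 = σ.pos
  fin : s.natArr 6 = σ.fin
  ident : s.natArr 7 = σ.ident
  lam_re : s.realReg 1 = e.lam.re
  lam_im : s.realReg 2 = e.lam.im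
  val_re : ∀ j, s.realArr 0 j = (σ.val j).re
  val_im : ∀ j, s.realArr 1 j = (σ.val j).im

variable {e : Env} {n i : ℕ} {σ : Config} {s : Store}

theorem Represents.push (h : Represents e n i σ s) :
    Represents e n i (σ.push e (s.natReg 6)) (pushProgram.eval s) := by
  obtain ⟨h0, h1, h2, h3, h4, h5, h8, a0, a1, a2, a3, a4, a5, a6, a7, r1, r2, v0, v1⟩ := h
  have key : (Test.natLt 3 1).Holds ((block [natAdd 1 1 4, natAdd 2 2 4, natStore 2 6 2,
      natStore 3 2 4, natStore 4 1 6, natStore 7 1 2, natLoad 7 0 6, natStore 5 1 7, natAdd 9 6 4,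
      natLoad 9 0 9]).eval s) ↔ e.depth < σ.level + 1 := by
    simp [Test.Holds, block, eval, run, Store.setNat, Store.setNatArr, h1, h3, h4]
  by_cases hd : e.depth < σ.level + 1
  all_goals
    have hd' := hd
    rw [← key] at hd
    constructor <;> simp only [pushProgram, eval, hd, hd', if_true, if_false, Config.push] <;>
      simp [block, eval, run, Store.setNat, Store.setNatArr, Store.setReal, Store.setRealArr,
        h0, h1, h2, h3, h4, h5, h8, a0, a1, a2, a3, a4, a5, a6, a7, r1, r2]
    all_goals
      intro j
      rcases eq_or_ne j (σ.level + 1) with rfl | hj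
      · simp
      · simp [hj, v0, v1]

/-- The quotient is computed as λ times the conjugate over the squared modulus. Real and complex
division by zero both give zero, so the simulation is exact without knowing that the partial
products do not vanish. -/
theorem Represents.pop (h : Represents e n i σ s) :
    Represents e n i (σ.pop e) (popProgram.eval s) := by
  obtain ⟨h0, h1, h2, h3, h4, h5, h8, a0, a1, a2, a3, a4, a5, a6, a7, r1, r2, v0, v1⟩ := h
  constructor <;>
    simp [popProgram, block, eval, run, Store.setNat, Store.setNatArr, Store.setReal,
      Store.setRealArr, Config.pop, h0, h1, h2, h3, h4, h5, h8, a0, a1, a2, a3, a4, a5, a6, a7,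
      r1, r2, v0, v1]
  all_goals
    intro j
    rcases eq_or_ne j (σ.level - 1) with rfl | hj
    · simp [Complex.div_re, Complex.div_im, Complex.normSq_apply]
      ring
    · simp [hj, v0, v1]

theorem Represents.step (h : Represents e n i σ s) (hσ : σ.level ≠ 0) :
    Represents e n i (σ.step e) (stepProgram.eval s) := by
  have hA : Represents e n i σ ((block [natLoad 7 5 1, natLoad 9 6 1]).eval s) := by
    obtain ⟨h0, h1, h2, h3, h4, h5, h8, a0, a1, a2, a3, a4, a5, a6, a7, r1, r2, v0, v1⟩ := h
    constructor <;> simp [block, eval, run, Store.setNat, *]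
  have hA7 : ((block [natLoad 7 5 1, natLoad 9 6 1]).eval s).natReg 7 = σ.pos σ.level := by
    simp [block, eval, run, Store.setNat, h.pos, h.level]
  have hA9 : ((block [natLoad 7 5 1, natLoad 9 6 1]).eval s).natReg 9 = σ.fin σ.level := by
    simp [block, eval, run, Store.setNat, h.fin, h.level]
  rw [Config.step, if_neg hσ, stepProgram, eval, eval]
  generalize (block [natLoad 7 5 1, natLoad 9 6 1]).eval s = s₁ at *
  by_cases hlt : σ.pos σ.level < σ.fin σ.level
  swap
  · have hT : ¬ (Test.natLt 7 9).Holds s₁ := by simpa [Test.Holds, hA7, hA9] using hlt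
    rw [if_neg hlt, if_neg hT]
    exact hA.pop
  have hT : (Test.natLt 7 9).Holds s₁ := by simpa [Test.Holds, hA7, hA9] using hlt
  rw [if_pos hlt, if_pos hT, eval, eval]
  have hB : Represents e n i σ.advance
      ((block [natLoad 6 1 7, natAdd 7 7 4, natStore 5 1 7, natLoad 9 2 6, natLoad 9 3 9]).eval
        s₁) := by
    obtain ⟨h0, h1, h2, h3, h4, h5, h8, a0, a1, a2, a3, a4, a5, a6, a7, r1, r2, v0, v1⟩ := hA
    constructor <;> simp [block, eval, run, Store.setNat, Store.setNatArr, Config.advance, *]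
  have hB6 : ((block [natLoad 6 1 7, natAdd 7 7 4, natStore 5 1 7, natLoad 9 2 6,
      natLoad 9 3 9]).eval s₁).natReg 6 = e.adj (σ.pos σ.level) := by
    simp [block, eval, run, Store.setNat, Store.setNatArr, hA.adj, hA7]
  have hB9 : ((block [natLoad 6 1 7, natAdd 7 7 4, natStore 5 1 7, natLoad 9 2 6,
      natLoad 9 3 9]).eval s₁).natReg 9 = σ.alive (σ.mark (e.adj (σ.pos σ.level))) := by
    simp [block, eval, run, Store.setNat, Store.setNatArr, hA.adj, hA.alive, hA.mark, hA7]
  generalize (block [natLoad 6 1 7, natAdd 7 7 4, natStore 5 1 7, natLoad 9 2 6,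
      natLoad 9 3 9]).eval s₁ = s₂ at *
  by_cases hal : σ.alive (σ.mark (e.adj (σ.pos σ.level))) < 1
  · have hT' : (Test.natLt 9 4).Holds s₂ := by simpa [Test.Holds, hB9, hB.one] using hal
    rw [if_pos hal, if_pos hT', ← hB6]
    exact hB.push
  · have hT' : ¬ (Test.natLt 9 4).Holds s₂ := by simpa [Test.Holds, hB9, hB.one] using hal
    rw [if_neg hal, if_neg hT', eval]
    exact hB

theorem loopFree_pushProgram : pushProgram.LoopFree :=
  ⟨loopFree_block _, ⟨loopFree_block _, trivial⟩, loopFree_block _⟩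

theorem loopFree_stepProgram : stepProgram.LoopFree :=
  ⟨loopFree_block _, ⟨loopFree_block _, loopFree_pushProgram, trivial⟩, loopFree_block _⟩

/-- The loop that runs the evaluation until no frame is open. -/
def stepsProgram : Program := .while (.natLt 8 1) stepProgram

/-- The automaton rests at level 0, so k may exceed the number of rounds that the loop really makes.
-/
theorem Represents.steps (k : ℕ) : ∀ {σ : Config} {s : Store}, Represents e n i σ s →
    ((Config.step e)^[k] σ).level = 0 →
    ∃ s', Runs stepsProgram s s' (k * (stepProgram.cost + 1) + 1) ∧
      Represents e n i ((Config.step e)^[k] σ) s' := by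
  induction k with
  | zero =>
    intro σ s h h0
    have h0' : σ.level = 0 := h0
    refine ⟨s, (Runs.while_of_not ?_).mono (by simp), h⟩
    simp [Test.Holds, h.level, h0']
  | succ k ih =>
    intro σ s h h0
    by_cases hσ : σ.level = 0
    · have hfix : Config.step e σ = σ := by simp [Config.step, hσ]
      rw [Function.iterate_fixed hfix]
      refine ⟨s, (Runs.while_of_not ?_).mono (by simp), h⟩
      simp [Test.Holds, h.level, hσ]
    · rw [Function.iterate_succ_apply] at h0 ⊢
      obtain ⟨s', hr, hs'⟩ := ih (h.step hσ) h0
      refine ⟨s', (Runs.while_of ?_ (loopFree_stepProgram.runs s) hr).mono ?_, hs'⟩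
      · simp [Test.Holds, h.level, h.zero]
        omega
      · rw [Nat.succ_mul]
        omega

/-- The program that evaluates the recursion for the vertex in natural register `5`. -/
def rootProgram : Program :=
  .seq (block [natCopy 6 5, natAdd 5 5 4]) (.seq pushProgram stepsProgram)

/-- The loop over all vertices. -/
def rootsProgram : Program := .while (.natLt 5 0) rootProgram

/-- A bound for the number of steps of one round of `rootsProgram`. -/
def rootCost (Δ d : ℕ) : ℕ :=
  pushProgram.cost + 4 + (Δ + 1) * (Δ + 1) ^ d * (stepProgram.cost + 1)

/-- The frame at level 0 has no vertex; it collects the outer product over all vertices. Only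
vertices before i are removed in round i, so the frame of i can be opened without a test. -/
theorem Represents.roots {Δ : ℕ} {L : Fin n → List (Fin n)} (he : e.Holds L)
    (hΔ : ∀ v, (L v).length ≤ Δ) (m : ℕ) : ∀ {i : ℕ} {σ : Config} {s : Store}, i + m = n →
    Represents e n i σ s → σ.Valid → σ.level = 0 → (∀ u ∈ σ.removed n, (u : ℕ) < i) →
    ∃ σ' s', Runs rootsProgram s s' (m * rootCost Δ e.depth + 1) ∧ Represents e n n σ' s' ∧
      σ'.val 0 = σ.val 0 * prodAlong (truncRatio e.lam L e.depth) (σ.removed n)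
        ((List.finRange n).drop i) := by
  induction m with
  | zero =>
    intro i σ s hi h _ _ _
    obtain rfl : i = n := by omega
    refine ⟨σ, s, (Runs.while_of_not ?_).mono (by simp), h, ?_⟩
    · simp [Test.Holds, h.size, h.index]
    · rw [List.drop_of_length_le (by simp)]
      simp [prodAlong]
  | succ m ih =>
    intro i σ s hi h hσ hlev hrem
    have hin : i < n := by omega
    have hnot : (⟨i, hin⟩ : Fin n) ∉ σ.removed n := fun hmem => lt_irrefl _ (hrem _ hmem)
    obtain ⟨k, hk, σ₁, hiter, hext, -, hval, hrem₁⟩ :=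
      evaluates_truncRatio he hΔ e.depth σ ⟨i, hin⟩ hσ (by omega) hnot
    have hA : Represents e n (i + 1) σ ((block [natCopy 6 5, natAdd 5 5 4]).eval s) := by
      obtain ⟨h0, h1, h2, h3, h4, h5, h8, a0, a1, a2, a3, a4, a5, a6, a7, r1, r2, v0, v1⟩ := h
      constructor <;> simp [block, eval, run, Store.setNat, *]
    have hA6 : ((block [natCopy 6 5, natAdd 5 5 4]).eval s).natReg 6 = i := by
      simp [block, eval, run, Store.setNat, h.index]
    have hpush := hA.push
    rw [hA6] at hpush
    have hlev₁ : σ₁.level = 0 := hext.level_eq.trans hlev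
    obtain ⟨s₁, hr, hs₁⟩ := hpush.steps k (by
      rw [← hlev₁, ← hiter])
    have hiter' : (Config.step e)^[k] (σ.push e i) = σ₁ := hiter
    rw [hiter'] at hs₁
    obtain ⟨σ', s', hr', hs', hval'⟩ := ih (by omega) hs₁ hext.valid hlev₁ (by
      intro u hu
      rw [hrem₁, Finset.mem_insert] at hu
      rcases hu with rfl | hu
      · simp
      · exact (hrem u hu).trans (Nat.lt_succ_self i))
    refine ⟨σ', s', (Runs.while_of ?_ (((loopFree_block _).runs s).seq
      ((loopFree_pushProgram.runs _).seq hr)) hr').mono ?_, hs', ?_⟩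
    · simp [Test.Holds, h.size, h.index, hin]
    · have := Nat.mul_le_mul_right (stepProgram.cost + 1) hk
      simp only [block, cost, rootCost, Nat.succ_mul m] at this ⊢
      omega
    · have hdrop : (List.finRange n).drop i = ⟨i, hin⟩ :: (List.finRange n).drop (i + 1) := by
        rw [List.drop_eq_getElem_cons (by simpa using hin)]
        simp
      rw [hval', hrem₁, hdrop]
      rw [hlev] at hval
      simp [prodAlong, hnot, hval, mul_assoc]

end DepthFirst

namespace DepthFirst

open RealRAM RealRAM.Program RealRAM.Instr

/-! ### The input -/

theorem getD_flatten (l : List (List ℕ)) : ∀ (k : ℕ) (hk : k < l.length) (i : ℕ)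
    (hi : i < l[k].length),
    l.flatten.getD (((l.take k).map List.length).sum + i) 0 = l[k][i] := by
  induction l with
  | nil => intro k hk; simp at hk
  | cons a l ih =>
    intro k hk i hi
    cases k with
    | zero =>
      simp only [List.getElem_cons_zero] at hi
      simp [List.getD_eq_getElem?_getD, List.getElem?_append_left hi, List.getElem?_eq_getElem hi]
    | succ k =>
      have := ih k (by simpa using hk) i (by simpa using hi)
      simp only [List.getElem_cons_succ]
      rw [← this]
      simp only [List.take_succ_cons, List.map_cons, List.sum_cons, List.flatten_cons,
        List.getD_eq_getElem?_getD]
      rw [List.getElem?_append_right (by omega)]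
      congr 2
      omega

theorem startPos_succ {n : ℕ} (L : Fin n → List (Fin n)) (v : Fin n) :
    startPos L (v + 1) = startPos L v + (L v).length := by
  have : (Finset.univ.filter fun u : Fin n => u.val < v + 1) =
      insert v (Finset.univ.filter fun u : Fin n => u.val < v) := by
    ext u
    simp only [Finset.mem_filter, Finset.mem_univ, true_and, Finset.mem_insert, Fin.ext_iff]
    omega
  rw [startPos, this, Finset.sum_insert (by simp), startPos, add_comm]

theorem startPos_eq_sum_take {n : ℕ} (L : Fin n → List (Fin n)) (k : ℕ) (hk : k ≤ n) :
    startPos L k =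
      (((List.ofFn fun v => (L v).map Fin.val).take k).map List.length).sum := by
  induction k with
  | zero => simp [startPos]
  | succ k ih =>
    have h1 := startPos_succ L ⟨k, hk⟩
    simp only at h1
    rw [h1, ih (by omega), List.take_succ_eq_append_getElem (by simpa using hk)]
    simp

/-- The environment given by the input. -/
noncomputable def inputEnv {n : ℕ} (L : Fin n → List (Fin n)) (ε : ℝ) (lam : ℂ) (d : ℕ) : Env where
  start := (input L ε lam).natArr 0
  adj := (input L ε lam).natArr 1
  depth := d
  lam := lam

theorem inputEnv_holds {n : ℕ} (L : Fin n → List (Fin n)) (ε : ℝ) (lam : ℂ) (d : ℕ) :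
    (inputEnv L ε lam d).Holds L := by
  intro v
  have hv := v.isLt
  have h1 : v.val + 1 ≤ n := hv
  refine ⟨?_, fun i hi => ?_⟩
  · simp [inputEnv, input, hv.le, h1, startPos_succ]
  · have := getD_flatten (List.ofFn fun v => (L v).map Fin.val) v (by simp) i (by simpa using hi)
    rw [← startPos_eq_sum_take L v hv.le] at this
    simpa [inputEnv, input, hv.le, entries] using this

/-- The state at the beginning of the evaluation: a frame without a vertex at level `0`. -/
noncomputable def initialConfig : Config where
  level := 0
  count := 1
  mark := fun _ => 0
  alive := Function.update (fun _ => 0) 1 1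
  vert := fun _ => 0
  pos := fun _ => 0
  fin := fun _ => 0
  ident := Function.update (fun _ => 0) 0 1
  val := Function.update (fun _ => 0) 0 1

theorem valid_initialConfig : initialConfig.Valid where
  mark_le _ := Nat.zero_le _
  alive_eq j hj := by
    simp only [initialConfig] at hj ⊢
    exact Function.update_of_ne hj.ne' _ _
  ident_le := by simp [initialConfig]
  alive_ident := by simp [initialConfig]

theorem removed_initialConfig (n : ℕ) : initialConfig.removed n = ∅ := by
  ext u
  simp [Config.mem_removed, initialConfig]

/-- The program that sets up the evaluation, replaces `ε` by its minimum with `1`, and computes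
`κ * (n + 1)`. -/
def setupProgram (κ : ℕ) (c : ℚ) : Program :=
  .seq (block [natConst 4 1, natConst 2 1, natStore 3 4 4, natStore 7 8 4, realConst 3 1,
      realStore 0 8 3])
    (.seq (.ite (.realLt 0 3) .skip (block [realCopy 0 3]))
      (block [realConst 4 κ, realOfNat 5 0, realAdd 5 5 3, realMul 4 4 5, realConst 5 c]))

theorem loopFree_setupProgram (κ : ℕ) (c : ℚ) : (setupProgram κ c).LoopFree :=
  ⟨loopFree_block _, ⟨trivial, loopFree_block _⟩, loopFree_block _⟩

/-- Identifier 0 is dead, so blank marks already say that no vertex is removed. The only array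
entries to be written are those of the bottom frame, with identifier 1 and value 1. -/
theorem represents_setup {n : ℕ} (L : Fin n → List (Fin n)) (ε : ℝ) (lam : ℂ) (κ : ℕ) (c : ℚ) :
    let s := (setupProgram κ c).eval (input L ε lam)
    Represents (inputEnv L ε lam 0) n 0 initialConfig s ∧ s.realReg 0 = min ε 1 ∧
      s.realReg 4 = κ * (n + 1) ∧ s.realReg 5 = c := by
  have key : (Test.realLt 0 3).Holds ((block [natConst 4 1, natConst 2 1, natStore 3 4 4,
      natStore 7 8 4, realConst 3 1, realStore 0 8 3]).eval (input L ε lam)) ↔ ε < 1 := by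
    simp [Test.Holds, block, eval, run, Store.setNat, Store.setNatArr, Store.setReal,
      Store.setRealArr, input]
  have hzero : ∀ A, 2 ≤ A → (input L ε lam).natArr A = fun _ => 0 := by
    intro A hA
    funext i
    have h0 : A ≠ 0 := by omega
    have h1 : A ≠ 1 := by omega
    simp [input, h0, h1]
  have hreg : ∀ r, r ≠ 0 → (input L ε lam).natReg r = 0 := fun r hr => by simp [input, hr]
  have hn : (input L ε lam).natReg 0 = n := rfl
  have hR0 : (input L ε lam).realReg 0 = ε := rfl
  have hR1 : (input L ε lam).realReg 1 = lam.re := rfl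
  have hR2 : (input L ε lam).realReg 2 = lam.im := rfl
  have hRA : ∀ A j, (input L ε lam).realArr A j = 0 := fun _ _ => rfl
  by_cases hε : ε < 1
  all_goals
    have hε' := hε
    rw [← key] at hε
    simp only [setupProgram, eval, hε, if_true, if_false]
    refine ⟨?_, ?_, ?_, ?_⟩
  case pos.refine_2 =>
    simp [block, eval, run, Store.setNat, Store.setNatArr, Store.setReal, Store.setRealArr, hR0,
      hε'.le]
  case neg.refine_2 =>
    simp [block, eval, run, Store.setNat, Store.setNatArr, Store.setReal, Store.setRealArr,
      not_lt.1 hε']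
  case pos.refine_1 | neg.refine_1 =>
    constructor <;> simp [block, eval, run, Store.setNat, Store.setNatArr, Store.setReal,
      Store.setRealArr, hreg, hn, hzero, hR1, hR2, inputEnv, initialConfig]
    all_goals
      intro j
      rcases eq_or_ne j 0 with rfl | hj
      · simp [hRA]
      · simp [hj, hRA]
  all_goals
    simp [block, eval, run, Store.setNat, Store.setNatArr, Store.setReal, Store.setRealArr, hn]

/-! ### Choice of the depth, the whole program, and its running time -/

/-- The loop that computes the depth of the recursion. -/
def depthProgram : Program :=
  .while (.realLt 0 4) (block [realMul 4 4 5, natAdd 3 3 4])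

theorem Represents.depthProgram {n i : ℕ} {σ : Config} {m c : ℝ} (k : ℕ) :
    ∀ {e : Env} {s : Store} {x : ℝ}, Represents e n i σ s → s.realReg 0 = m → s.realReg 4 = x →
    s.realReg 5 = c → (∀ j < k, m < x * c ^ j) → x * c ^ k ≤ m →
    ∃ s', Runs depthProgram s s' (3 * k + 1) ∧
      Represents { e with depth := e.depth + k } n i σ s' := by
  induction k with
  | zero =>
    intro e s x h h0 h4 _ _ hx
    refine ⟨s, Runs.while_of_not ?_, h⟩
    simpa [Test.Holds, h0, h4] using hx
  | succ k ih =>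
    intro e s x h h0 h4 h5 hlt hx
    have hA : Represents { e with depth := e.depth + 1 } n i σ
        ((block [realMul 4 4 5, natAdd 3 3 4]).eval s) := by
      obtain ⟨g0, g1, g2, g3, g4, g5, g8, a0, a1, a2, a3, a4, a5, a6, a7, r1, r2, v0, v1⟩ := h
      constructor <;> simp [block, eval, run, Store.setNat, Store.setReal, *]
    obtain ⟨s', hr, hs'⟩ := ih (x := x * c) hA
      (by simp [block, eval, run, Store.setNat, Store.setReal, h0])
      (by simp [block, eval, run, Store.setNat, Store.setReal, h4, h5])
      (by simp [block, eval, run, Store.setNat, Store.setReal, h5])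
      (fun j hj => by
        have := hlt (j + 1) (by omega)
        rwa [pow_succ', ← mul_assoc] at this)
      (by rwa [pow_succ', ← mul_assoc] at hx)
    refine ⟨s', (Runs.while_of ?_ ((loopFree_block _).runs s) hr).mono ?_, ?_⟩
    · simpa [Test.Holds, h0, h4] using hlt 0 (by omega)
    · simp only [block, cost]
      omega
    · simpa [add_assoc, add_comm 1 k] using hs'

/-- The whole algorithm. -/
def program (κ : ℕ) (c : ℚ) : Program :=
  .seq (setupProgram κ c) (.seq depthProgram (.seq rootsProgram
    (block [realLoad 0 0 8, realLoad 1 1 8])))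

theorem runs_program {n Δ : ℕ} {L : Fin n → List (Fin n)} (hΔ : ∀ v, (L v).length ≤ Δ) (ε : ℝ)
    (lam : ℂ) (κ : ℕ) (c : ℚ) {d : ℕ} (hlt : ∀ j < d, min ε 1 < κ * (n + 1) * (c : ℝ) ^ j)
    (hd : κ * (n + 1) * (c : ℝ) ^ d ≤ min ε 1) :
    ∃ s, Runs (program κ c) (input L ε lam) s
        ((setupProgram κ c).cost + (3 * d + 1 + (n * rootCost Δ d + 1 + 2))) ∧
      output s = prodAlong (truncRatio lam L d) ∅ (List.finRange n) := by
  obtain ⟨h, h0, h4, h5⟩ := represents_setup L ε lam κ c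
  obtain ⟨s₁, hr₁, hs₁⟩ := h.depthProgram d h0 h4 h5 hlt hd
  have henv : ({ inputEnv L ε lam 0 with depth := (inputEnv L ε lam 0).depth + d } : Env) =
      inputEnv L ε lam d := by
    simp [inputEnv]
  rw [henv] at hs₁
  obtain ⟨σ, s₂, hr₂, hs₂, hval⟩ := hs₁.roots (inputEnv_holds L ε lam d) hΔ n (by simp)
    valid_initialConfig rfl (by simp [removed_initialConfig])
  refine ⟨_, ((loopFree_setupProgram κ c).runs _).seq
    (hr₁.seq (hr₂.seq ((loopFree_block _).runs s₂))), ?_⟩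
  have hval' : σ.val 0 = prodAlong (truncRatio lam L d) ∅ (List.finRange n) := by
    rw [hval, removed_initialConfig]
    simp [initialConfig, inputEnv]
  rw [← hval']
  apply Complex.ext <;>
    simp [output, block, eval, run, Store.setReal, hs₂.zero, hs₂.val_re, hs₂.val_im]

/-- The number of steps is polynomial if the depth is logarithmic. -/
theorem time_le {Δ k κ : ℕ} {c : ℝ} (hΔ : 1 ≤ Δ) (hc0 : 0 < c) (hc1 : c < 1)
    (hk : (Δ + 1 : ℝ) ≤ c⁻¹ ^ k) (hκ : 1 ≤ κ) (A : ℕ) :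
    ∃ K : ℕ, ∀ (n d : ℕ) (m : ℝ), 0 < m → m ≤ 1 →
      (∀ j < d, m < κ * (n + 1) * c ^ j) →
      ((A + (3 * d + 1 + (n * rootCost Δ d + 1 + 2)) : ℕ) : ℝ) ≤ K * ((n + 1) / m) ^ K := by
  set B := A + 7 + pushProgram.cost + 4 + (Δ + 1) * (stepProgram.cost + 1) with hB
  obtain ⟨K₁, hK₁⟩ := exists_nat_ge ((B : ℝ) * (c⁻¹ * κ) ^ k)
  -- One number serves as coefficient and as exponent: K₁ bounds the former, k + 1 the latter.
  refine ⟨max K₁ (k + 1), fun n d m hm hm1 hlt => ?_⟩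
  have hb : 1 ≤ c⁻¹ := (one_le_inv₀ hc0).2 hc1.le
  have hκ' : (1 : ℝ) ≤ κ := by exact_mod_cast hκ
  have hY : 1 ≤ ((n : ℝ) + 1) / m := by
    rw [le_div_iff₀ hm]
    have : (0 : ℝ) ≤ n := Nat.cast_nonneg n
    linarith
  -- The stopping criterion still fails at d - 1, which bounds c⁻¹ ^ (d - 1). As Δ + 1 ≤ c⁻¹ ^ k,
  -- the size of the recursion tree is bounded by the k-th power of this.
  have hpow : c⁻¹ ^ d ≤ c⁻¹ * κ * ((n + 1) / m) := by
    cases d with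
    | zero =>
      rw [pow_zero]
      exact one_le_mul_of_one_le_of_one_le (one_le_mul_of_one_le_of_one_le hb hκ') hY
    | succ d =>
      have h1 := hlt d (Nat.lt_succ_self d)
      rw [pow_succ', mul_assoc]
      refine mul_le_mul_of_nonneg_left ?_ (by positivity)
      rw [inv_pow, ← mul_div_assoc, inv_eq_one_div, div_le_div_iff₀ (by positivity) hm]
      linarith
  have hpow' : ((Δ : ℝ) + 1) ^ d ≤ (c⁻¹ * κ) ^ k * ((n + 1) / m) ^ k := by
    calc ((Δ : ℝ) + 1) ^ d ≤ (c⁻¹ ^ k) ^ d := by gcongr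
      _ = (c⁻¹ ^ d) ^ k := by rw [← pow_mul, ← pow_mul, mul_comm]
      _ ≤ (c⁻¹ * κ * ((n + 1) / m)) ^ k := by gcongr
      _ = _ := mul_pow _ _ _
  have hnat : A + (3 * d + 1 + (n * rootCost Δ d + 1 + 2)) ≤ B * ((n + 1) * (Δ + 1) ^ d) := by
    have hP : d ≤ (Δ + 1) ^ d := (Nat.lt_pow_self (by omega)).le
    have hP1 : 1 ≤ (Δ + 1) ^ d := Nat.one_le_pow _ _ (by omega)
    rw [rootCost]
    generalize (Δ + 1) ^ d = P at *
    have hQ1 : 1 ≤ (n + 1) * P := Nat.mul_pos (Nat.succ_pos n) hP1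
    have hQd : d ≤ (n + 1) * P := hP.trans (Nat.le_mul_of_pos_left _ (Nat.succ_pos n))
    have hQn : n ≤ (n + 1) * P := (Nat.le_succ n).trans (Nat.le_mul_of_pos_right _ hP1)
    have hQnP : n * P ≤ (n + 1) * P := Nat.mul_le_mul_right P (Nat.le_succ n)
    generalize (n + 1) * P = Q at *
    calc A + (3 * d + 1 +
          (n * (pushProgram.cost + 4 + (Δ + 1) * P * (stepProgram.cost + 1)) + 1 + 2))
        = A * 1 + 3 * d + 4 * 1 + n * (pushProgram.cost + 4) +
            n * P * ((Δ + 1) * (stepProgram.cost + 1)) := by ring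
      _ ≤ A * Q + 3 * Q + 4 * Q + Q * (pushProgram.cost + 4) +
            Q * ((Δ + 1) * (stepProgram.cost + 1)) := by gcongr
      _ = B * Q := by rw [hB]; ring
  have hn1 : ((n : ℝ) + 1) ≤ (n + 1) / m := by
    rw [le_div_iff₀ hm]
    exact mul_le_of_le_one_right (by positivity) hm1
  calc ((A + (3 * d + 1 + (n * rootCost Δ d + 1 + 2)) : ℕ) : ℝ)
      ≤ ((B * ((n + 1) * (Δ + 1) ^ d) : ℕ) : ℝ) := by exact_mod_cast hnat
    _ = B * ((n + 1) * ((Δ : ℝ) + 1) ^ d) := by push_cast; ring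
    _ ≤ B * ((n + 1) / m * ((c⁻¹ * κ) ^ k * ((n + 1) / m) ^ k)) := by gcongr
    _ = B * (c⁻¹ * κ) ^ k * ((n + 1) / m) ^ (k + 1) := by ring
    _ ≤ (max K₁ (k + 1) : ℕ) * ((n + 1) / m) ^ (max K₁ (k + 1)) := by
        refine mul_le_mul (hK₁.trans ?_) (pow_le_pow_right₀ hY (le_max_right _ _)) (by positivity)
          (by positivity)
        exact_mod_cast le_max_left _ _

end DepthFirst

/-! ### Choice of the constants and conclusion -/

theorem theorem1p2 (Δ : ℕ) (hΔ : 2 ≤ Δ) (lam : ℂ) (hlam : ‖lam‖ < lambdaStar Δ) :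
    ∃ (p : RealRAM.Program) (K : ℕ),
      ∀ (n : ℕ) (G : SimpleGraph (Fin n)) [DecidableRel G.Adj], G.maxDegree ≤ Δ →
        ∀ L : Fin n → List (Fin n), RealRAM.IsAdjacencyList G L →
          ∀ ε : ℝ, 0 < ε →
            ∃ (s : RealRAM.Store) (t : ℕ),
              RealRAM.Exec p (RealRAM.input L ε lam) s t ∧
              (t : ℝ) ≤ K * (((n : ℝ) + 1) / min ε 1) ^ K ∧
              IsMultApprox ε (G.independencePolynomial.eval lam) (RealRAM.output s) := by
  have hΔ0 : (0 : ℝ) < Δ := by exact_mod_cast (by omega : 0 < Δ)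
  have hstar := lambdaStar_mul_eq_one hΔ
  have hpos : (0 : ℝ) < Δ * (1 - (Δ : ℝ)⁻¹)⁻¹ ^ (Δ - 1) := by
    have : (Δ : ℝ)⁻¹ < 1 := inv_lt_one_of_one_lt₀ (by exact_mod_cast (by omega : 1 < Δ))
    have : 0 < 1 - (Δ : ℝ)⁻¹ := by linarith
    positivity
  have hlt1 : ‖lam‖ * Δ * (1 - (Δ : ℝ)⁻¹)⁻¹ ^ (Δ - 1) < 1 := by
    rw [mul_assoc] at hstar ⊢
    exact (mul_lt_mul_of_pos_right hlam hpos).trans_eq hstar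
  -- The contraction rate is taken rational because it becomes a literal of the program.
  obtain ⟨c, hc, hc1⟩ := exists_rat_btwn hlt1
  have hc0 : (0 : ℝ) < c := by
    refine lt_of_le_of_lt ?_ hc
    rw [mul_assoc]
    positivity
  obtain ⟨κ, hκ⟩ := exists_nat_ge (8 / (1 - (c : ℝ)))
  have h1c : 0 < 1 - (c : ℝ) := by linarith
  have hκ8 : 8 ≤ κ * (1 - (c : ℝ)) := (div_le_iff₀ h1c).1 hκ
  have hκ1 : 1 ≤ κ := by
    by_contra h0
    obtain rfl : κ = 0 := by omega
    norm_num at hκ8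
  obtain ⟨k, hk⟩ := pow_unbounded_of_one_lt ((Δ : ℝ) + 1) ((one_lt_inv₀ hc0).2 hc1)
  obtain ⟨K, hK⟩ := DepthFirst.time_le (by omega) hc0 hc1 hk.le hκ1
    (DepthFirst.setupProgram κ c).cost
  refine ⟨DepthFirst.program κ c, K, fun n G _ hG L hL ε hε => ?_⟩
  have hlen : ∀ v, (L v).length ≤ Δ := by
    intro v
    refine le_trans ?_ ((G.degree_le_maxDegree v).trans hG)
    rw [← List.toFinset_card_of_nodup (hL v).1, ← G.card_neighborFinset_eq_degree]
    refine Finset.card_le_card fun w hw => ?_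
    simpa [(hL v).2] using hw
  have hsub : Subcritical G L Δ lam c := ⟨fun v w => (hL v).2 w, hlen, hΔ, hc.le, hc1⟩
  have hm : 0 < min ε 1 := lt_min hε one_pos
  have hx : 0 < (κ : ℝ) * (n + 1) := by
    have : (0 : ℝ) < κ := by exact_mod_cast hκ1
    positivity
  have hex : ∃ d, κ * (n + 1) * (c : ℝ) ^ d ≤ min ε 1 := by
    obtain ⟨d, hd⟩ := exists_pow_lt_of_lt_one (div_pos hm hx) hc1
    exact ⟨d, by rw [lt_div_iff₀ hx] at hd; linarith⟩
  classical
  -- The least such d is the depth at which the program's own loop stops: the inequality at d gives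
  -- the accuracy, minimality gives the running time.
  obtain ⟨d, hd, hlt⟩ : ∃ d, κ * (n + 1) * (c : ℝ) ^ d ≤ min ε 1 ∧
      ∀ j < d, min ε 1 < κ * (n + 1) * (c : ℝ) ^ j :=
    ⟨Nat.find hex, Nat.find_spec hex, fun j hj => not_le.1 (Nat.find_min hex hj)⟩
  obtain ⟨s, ⟨t, ht, hexec⟩, hout⟩ := DepthFirst.runs_program hlen ε lam κ c hlt hd
  refine ⟨s, t, hexec, le_trans (by exact_mod_cast ht) (hK n d _ hm (min_le_right _ _) hlt), ?_⟩
  have hcd : 0 < (c : ℝ) ^ d := pow_pos hc0 d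
  -- The 8 in the choice of κ is 4 from the root error times 2. The factor 1/2 makes the relative
  -- error of each factor at most 1/2 and absorbs the 3/2 from the logarithm.
  have hquot : 4 * (c : ℝ) ^ d / (1 - c) ≤ κ * c ^ d / 2 := by
    rw [div_le_div_iff₀ h1c two_pos]
    nlinarith
  have hκc : κ * (c : ℝ) ^ d ≤ κ * (n + 1) * (c : ℝ) ^ d := by
    have : (0 : ℝ) ≤ κ * n * (c : ℝ) ^ d := by positivity
    linarith
  obtain ⟨z, hz, hzn⟩ := hsub.eval_eq_prodAlong_mul_exp (l := List.finRange n) (by simp) (d := d)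
    (by linarith [min_le_right ε 1])
  rw [hout]
  refine isMultApprox_of_eq_mul_exp ?_ hz (hzn.trans (le_trans ?_ hd))
  · rw [← hardcoreSum_empty]
    exact hsub.hardcoreSum_ne_zero ∅
  · rw [List.length_finRange]
    have h3 : 3 / 2 * (4 * (c : ℝ) ^ d / (1 - c)) ≤ κ * c ^ d := by
      have : (0 : ℝ) ≤ κ * (c : ℝ) ^ d := by positivity
      linarith
    have h4 := mul_le_mul_of_nonneg_left h3 (Nat.cast_nonneg (α := ℝ) n)
    have : (0 : ℝ) ≤ κ * (c : ℝ) ^ d := by positivity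
    linarith
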